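/- Let $A \subset B$ be an extension of integral domains and let $R = A + XB[X]$ be the subring of $B[X]$ consisting of the polynomials whose constant term lies in $A$, graded by $\mathbb{Z}_{\ge 0}$ in the natural way ($R_0 = A$ and $R_n = BX^n$ for $n \ge 1$). Then $Cl(R) = HCl(R)$ if and only if $B$ is integrally closed (in its quotient field). Here, for an integral domain $R$ with quotient field $K$ and a nonzero fractional ideal $I$ of $R$, put $I^{-1} = \{x \in K \mid xI \subset R\}$, $I_v = (I^{-1})^{-1}$ and $I_t = \bigcup J_v$, where $J$ ranges over the nonzero finitely generated fractional ideals contained in $I$. The ideal $I$ is a $t$-ideal if $I_t = I$. The nonzero fractional $t$-ideals form a commutative monoid with unit $R$ under $(I,J) \mapsto (IJ)_t$, and its invertible elements are called $t$-invertible; they form a group $T(R)$, which contains the group $P(R)$ of nonzero principal fractional ideals, and $Cl(R) = T(R)/P(R)$. When $R$ is a graded domain, a fractional ideal $I$ is homogeneous if $sI$ is a homogeneous (integral) ideal of $R$ for some nonzero homogeneous $s \in R$. The homogeneous members of $T(R)$ form a subgroup $HT(R)$, with $HP(R) = HT(R) \cap P(R)$, and $HCl(R) = HT(R)/HP(R)$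 is regarded as a subgroup of $Cl(R)$ via the natural injection. Thus $Cl(R) = HCl(R)$ means that every class in $Cl(R)$ contains a homogeneous $t$-invertible fractional $t$-ideal. -/

import Mathlib

namespace GradedDomain

set_option linter.unusedSectionVars false

open scoped nonZeroDivisors

section Closure

variable {R K : Type*} [CommRing R] [IsDomain R] [Field K] [Algebra R K] [IsFractionRing R K]

/-- The `v`-closure `I_v = (I⁻¹)⁻¹`, where `I⁻¹ = (R : I)` is written `1 / I`. -/
noncomputable def vClosure (I : FractionalIdeal R⁰ K) : FractionalIdeal R⁰ K :=
  1 / (1 / I)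

theorem one_div_ne_zero' {I : FractionalIdeal R⁰ K} (hI : I ≠ 0) : 1 / I ≠ 0 := by
  obtain ⟨a, ha, h⟩ := I.isFractional
  intro h0
  have : algebraMap R K a ∈ 1 / I := by
    rw [FractionalIdeal.mem_div_iff_of_ne_zero hI]
    intro y hy
    obtain ⟨r, hr⟩ := h y hy
    rw [FractionalIdeal.mem_one_iff]
    exact ⟨r, by rw [hr, Algebra.smul_def]⟩
  rw [h0, FractionalIdeal.mem_zero_iff] at this
  exact nonZeroDivisors.ne_zero ha ((IsFractionRing.to_map_eq_zero_iff (K := K)).1 this)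

theorem vClosure_zero : vClosure (0 : FractionalIdeal R⁰ K) = 0 := by
  simp [vClosure, FractionalIdeal.div_zero]

theorem mem_vClosure {I : FractionalIdeal R⁰ K} (hI : I ≠ 0) {x : K} :
    x ∈ vClosure I ↔
      ∀ z : K, (∀ y ∈ I, z * y ∈ (1 : FractionalIdeal R⁰ K)) →
        x * z ∈ (1 : FractionalIdeal R⁰ K) := by
  rw [vClosure, FractionalIdeal.mem_div_iff_of_ne_zero (one_div_ne_zero' hI)]
  simp only [FractionalIdeal.mem_div_iff_of_ne_zero hI]

theorem le_vClosure (I : FractionalIdeal R⁰ K) : I ≤ vClosure I := by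
  by_cases hI : I = 0
  · rw [hI]; exact zero_le
  · intro x hx
    refine (mem_vClosure hI).2 fun z hz => ?_
    rw [mul_comm]; exact hz x hx

theorem vClosure_ne_zero {I : FractionalIdeal R⁰ K} (hI : I ≠ 0) : vClosure I ≠ 0 :=
  one_div_ne_zero' (one_div_ne_zero' hI)

theorem vClosure_le_of_le {I J : FractionalIdeal R⁰ K} (h : I ≤ vClosure J) :
    vClosure I ≤ vClosure J := by
  by_cases hI : I = 0
  · rw [hI, vClosure_zero]; exact zero_le
  by_cases hJ : J = 0
  · rw [hJ, vClosure_zero] at h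
    exact absurd (le_antisymm h zero_le) hI
  intro x hx
  refine (mem_vClosure hJ).2 fun z hz => (mem_vClosure hI).1 hx z fun y hy => ?_
  rw [mul_comm]
  exact (mem_vClosure hJ).1 (h hy) z hz

theorem vClosure_mono {I J : FractionalIdeal R⁰ K} (h : I ≤ J) : vClosure I ≤ vClosure J :=
  vClosure_le_of_le (h.trans (le_vClosure J))

theorem mul_ne_zero' {I J : FractionalIdeal R⁰ K} (hI : I ≠ 0) (hJ : J ≠ 0) : I * J ≠ 0 := by
  obtain ⟨x, hx, hx0⟩ := (Submodule.ne_bot_iff _).1 (FractionalIdeal.coeToSubmodule_ne_bot.2 hI)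
  obtain ⟨y, hy, hy0⟩ := (Submodule.ne_bot_iff _).1 (FractionalIdeal.coeToSubmodule_ne_bot.2 hJ)
  intro h
  have := FractionalIdeal.mul_mem_mul (I := I) (J := J) hx hy
  rw [h, FractionalIdeal.mem_zero_iff] at this
  exact (mul_ne_zero hx0 hy0) this

theorem mul_mem_vClosure (a : K) {x : K} {I : FractionalIdeal R⁰ K} (hx : x ∈ vClosure I) :
    a * x ∈ vClosure (FractionalIdeal.spanSingleton R⁰ a * I) := by
  by_cases ha : a = 0
  · rw [ha, zero_mul]; exact FractionalIdeal.zero_mem _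
  by_cases hI : I = 0
  · rw [hI, vClosure_zero, FractionalIdeal.mem_zero_iff] at hx
    rw [hx, mul_zero]; exact FractionalIdeal.zero_mem _
  have h : FractionalIdeal.spanSingleton R⁰ a * I ≠ 0 :=
    mul_ne_zero' (FractionalIdeal.spanSingleton_ne_zero_iff.2 ha) hI
  refine (mem_vClosure h).2 fun z hz => ?_
  have := (mem_vClosure hI).1 hx (z * a) fun y hy => by
    rw [mul_assoc]
    exact hz _ (FractionalIdeal.mul_mem_mul (FractionalIdeal.mem_spanSingleton_self _ a) hy)
  convert this using 1
  ring

theorem exists_mem_vClosure_add {I : FractionalIdeal R⁰ K} {x y : K}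
    (hx : ∃ J ≤ I, (J : Submodule R K).FG ∧ x ∈ vClosure J)
    (hy : ∃ J ≤ I, (J : Submodule R K).FG ∧ y ∈ vClosure J) :
    ∃ J ≤ I, (J : Submodule R K).FG ∧ x + y ∈ vClosure J := by
  obtain ⟨J, hJ, hf, hx⟩ := hx
  obtain ⟨J', hJ', hf', hy⟩ := hy
  refine ⟨J ⊔ J', sup_le hJ hJ', ?_, ?_⟩
  · rw [FractionalIdeal.coe_sup]; exact hf.sup hf'
  · exact (vClosure (J ⊔ J')).coeToSubmodule.add_mem (vClosure_mono le_sup_left hx)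
      (vClosure_mono le_sup_right hy)

/-- The `t`-closure `I_t`: the union of the `J_v`, for `J` finitely generated and contained
in `I`. -/
noncomputable def tClosure (I : FractionalIdeal R⁰ K) : FractionalIdeal R⁰ K :=
  ⟨{ carrier := {x | ∃ J ≤ I, (J : Submodule R K).FG ∧ x ∈ vClosure J}
     add_mem' := exists_mem_vClosure_add
     zero_mem' := ⟨0, zero_le, by simpa using Submodule.fg_bot, FractionalIdeal.zero_mem _⟩
     smul_mem' := fun r _ ⟨J, hJ, hf, hx⟩ =>
      ⟨J, hJ, hf, (vClosure J).coeToSubmodule.smul_mem r hx⟩ },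
    by
      obtain ⟨a, ha, h⟩ := (vClosure I).isFractional
      exact ⟨a, ha, fun x ⟨J, hJ, _, hx⟩ => h x (vClosure_mono hJ hx)⟩⟩

theorem mem_tClosure {I : FractionalIdeal R⁰ K} {x : K} :
    x ∈ tClosure I ↔ ∃ J ≤ I, (J : Submodule R K).FG ∧ x ∈ vClosure J :=
  Iff.rfl

theorem tClosure_mono {I J : FractionalIdeal R⁰ K} (h : I ≤ J) : tClosure I ≤ tClosure J :=
  fun _ ⟨F, hF, hf, hx⟩ => ⟨F, hF.trans h, hf, hx⟩

theorem le_tClosure (I : FractionalIdeal R⁰ K) : I ≤ tClosure I := fun x hx =>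
  ⟨FractionalIdeal.spanSingleton R⁰ x, FractionalIdeal.spanSingleton_le_iff_mem.2 hx,
    by rw [FractionalIdeal.coe_spanSingleton]; exact Submodule.fg_span_singleton x,
    le_vClosure _ (FractionalIdeal.mem_spanSingleton_self _ x)⟩

theorem tClosure_le_vClosure (I : FractionalIdeal R⁰ K) : tClosure I ≤ vClosure I :=
  fun _ ⟨_, hF, _, hx⟩ => vClosure_mono hF hx

theorem tClosure_ne_zero {I : FractionalIdeal R⁰ K} (hI : I ≠ 0) : tClosure I ≠ 0 := fun h =>
  hI (le_antisymm (h ▸ le_tClosure I) zero_le)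

theorem exists_fg_le_vClosure {I J : FractionalIdeal R⁰ K} (hJ : J ≤ tClosure I)
    (hf : (J : Submodule R K).FG) :
    ∃ F ≤ I, (F : Submodule R K).FG ∧ J ≤ vClosure F := by
  obtain ⟨s, hs⟩ := hf
  have key : ∀ s : Finset K, (∀ x ∈ s, x ∈ tClosure I) →
      ∃ F ≤ I, (F : Submodule R K).FG ∧ ∀ x ∈ s, x ∈ vClosure F := by
    classical
    intro s
    induction s using Finset.induction_on with
    | empty => exact fun _ => ⟨0, zero_le, by simpa using Submodule.fg_bot, by simp⟩
    | insert a s _ ih =>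
      intro h
      obtain ⟨F, hF, hf, hx⟩ := ih fun x hx => h x (Finset.mem_insert_of_mem hx)
      obtain ⟨F', hF', hf', hx'⟩ := h a (Finset.mem_insert_self a s)
      refine ⟨F ⊔ F', sup_le hF hF', ?_, fun x hxs => ?_⟩
      · rw [FractionalIdeal.coe_sup]; exact hf.sup hf'
      · rcases Finset.mem_insert.1 hxs with rfl | h
        · exact vClosure_mono le_sup_right hx'
        · exact vClosure_mono le_sup_left (hx x h)
  obtain ⟨F, hF, hf, hx⟩ := key s fun x hx => hJ (by
    rw [← FractionalIdeal.mem_coe, ← hs]; exact Submodule.subset_span hx)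
  refine ⟨F, hF, hf, ?_⟩
  have : (J : Submodule R K) ≤ (vClosure F : Submodule R K) := by
    rw [← hs, Submodule.span_le]; exact hx
  exact this

theorem tClosure_le_of_le {I J : FractionalIdeal R⁰ K} (h : I ≤ tClosure J) :
    tClosure I ≤ tClosure J := by
  rintro x ⟨F, hF, hf, hx⟩
  obtain ⟨G, hG, hg, hFG⟩ := exists_fg_le_vClosure (hF.trans h) hf
  exact ⟨G, hG, hg, vClosure_le_of_le hFG hx⟩

theorem tClosure_tClosure (I : FractionalIdeal R⁰ K) : tClosure (tClosure I) = tClosure I :=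
  le_antisymm (tClosure_le_of_le le_rfl) (le_tClosure _)

theorem tClosure_mul_le (I J : FractionalIdeal R⁰ K) : tClosure I * J ≤ tClosure (I * J) := by
  rw [FractionalIdeal.mul_le]
  rintro x ⟨F, hF, hf, hx⟩ y hy
  refine ⟨FractionalIdeal.spanSingleton R⁰ y * F, ?_, ?_, ?_⟩
  · rw [mul_comm]
    exact mul_le_mul' hF (FractionalIdeal.spanSingleton_le_iff_mem.2 hy)
  · rw [FractionalIdeal.coe_mul, FractionalIdeal.coe_spanSingleton]
    exact (Submodule.fg_span_singleton y).mul hf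
  · rw [mul_comm x y]; exact mul_mem_vClosure y hx

theorem tClosure_tClosure_mul (I J : FractionalIdeal R⁰ K) :
    tClosure (tClosure I * J) = tClosure (I * J) :=
  le_antisymm (tClosure_le_of_le (tClosure_mul_le I J))
    (tClosure_mono (mul_le_mul_left (le_tClosure I) J))

theorem tClosure_spanSingleton (x : K) :
    tClosure (FractionalIdeal.spanSingleton R⁰ x) = FractionalIdeal.spanSingleton R⁰ x := by
  refine le_antisymm ((tClosure_le_vClosure _).trans ?_) (le_tClosure _)
  rw [vClosure, FractionalIdeal.one_div_spanSingleton, FractionalIdeal.one_div_spanSingleton,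
    inv_inv]

theorem tClosure_one : tClosure (1 : FractionalIdeal R⁰ K) = 1 := by
  rw [← FractionalIdeal.spanSingleton_one]; exact tClosure_spanSingleton 1

end Closure

section ClassGroup

variable (R : Type*) [CommRing R] [IsDomain R]

/-- The nonzero fractional `t`-ideals `I` of `R`, in the quotient field of `R`. -/
@[ext]
structure TIdeal where
  /-- the underlying fractional ideal -/
  val : FractionalIdeal R⁰ (FractionRing R)
  ne_zero : val ≠ 0
  tClosure_eq : tClosure val = val

variable {R}

/-- The `t`-multiplication `(I, J) ↦ (I J)_t`, with unit `R`. -/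
noncomputable instance : CommMonoid (TIdeal R) where
  mul I J := ⟨tClosure (I.val * J.val), tClosure_ne_zero (mul_ne_zero' I.ne_zero J.ne_zero),
    tClosure_tClosure _⟩
  one := ⟨1, one_ne_zero, tClosure_one⟩
  mul_comm I J := TIdeal.ext (congrArg tClosure (mul_comm I.val J.val))
  mul_assoc I J H := TIdeal.ext <| by
    change tClosure (tClosure (I.val * J.val) * H.val) =
      tClosure (I.val * tClosure (J.val * H.val))
    rw [tClosure_tClosure_mul, mul_comm I.val (tClosure _), tClosure_tClosure_mul, mul_assoc,
      mul_comm I.val]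
  one_mul I := TIdeal.ext <| by
    change tClosure (1 * I.val) = I.val
    rw [one_mul, I.tClosure_eq]
  mul_one I := TIdeal.ext <| by
    change tClosure (I.val * 1) = I.val
    rw [mul_one, I.tClosure_eq]

theorem TIdeal.val_mul (I J : TIdeal R) : (I * J).val = tClosure (I.val * J.val) := rfl

theorem TIdeal.val_one : (1 : TIdeal R).val = 1 := rfl

variable (R)

/-- The group `T(R)` of `t`-invertible fractional `t`-ideals of `R`, under `t`-multiplication. -/
abbrev TInvertible : Type _ := (TIdeal R)ˣ

/-- The map sending `x ≠ 0` in the quotient field to the principal fractional ideal `x R`. -/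
noncomputable def principal : (FractionRing R)ˣ →* TInvertible R :=
  MonoidHom.toHomUnits
    { toFun := fun x => ⟨FractionalIdeal.spanSingleton R⁰ (x : FractionRing R),
        FractionalIdeal.spanSingleton_ne_zero_iff.2 x.ne_zero, tClosure_spanSingleton _⟩
      map_one' := TIdeal.ext FractionalIdeal.spanSingleton_one
      map_mul' := fun x y => TIdeal.ext <| by
        rw [TIdeal.val_mul, FractionalIdeal.spanSingleton_mul_spanSingleton,
          tClosure_spanSingleton]
        rfl }

/-- The class group `Cl(R) = T(R) / P(R)`, where `P(R)` is the group of nonzero principal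
fractional ideals. -/
abbrev Cl : Type _ := TInvertible R ⧸ (principal R).range

variable {R}

/-- The inverse of a `t`-invertible `t`-ideal `I` is `I⁻¹ = (R : I)`. -/
theorem TInvertible.val_inv (u : TInvertible R) :
    (u⁻¹ : TInvertible R).val.val = 1 / u.val.val := by
  have h1 : tClosure (u.val.val * (u⁻¹ : TInvertible R).val.val) = 1 := by
    rw [← TIdeal.val_mul, Units.mul_inv, TIdeal.val_one]
  apply le_antisymm
  · rw [FractionalIdeal.le_div_iff_mul_le u.val.ne_zero, mul_comm, ← h1]
    exact le_tClosure _
  · have h2 : 1 / u.val.val = tClosure (u.val.val * (u⁻¹ : TInvertible R).val.val) *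
        (1 / u.val.val) := by rw [h1, one_mul]
    rw [h2, ← (u⁻¹ : TInvertible R).val.tClosure_eq]
    refine (tClosure_mul_le _ _).trans (tClosure_mono ?_)
    rw [(u⁻¹ : TInvertible R).val.tClosure_eq, mul_right_comm]
    calc _ ≤ 1 * (u⁻¹ : TInvertible R).val.val :=
          mul_le_mul_left FractionalIdeal.mul_one_div_le_one _
      _ = _ := one_mul _

end ClassGroup


section Homogeneous

variable {ι σ R K : Type*} [DecidableEq ι] [AddCancelCommMonoid ι] [CommRing R] [IsDomain R]
  [SetLike σ R] [AddSubmonoidClass σ R] (𝒜 : ι → σ) [GradedRing 𝒜]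
  [Field K] [Algebra R K] [IsFractionRing R K]

/-- A fractional ideal `I` of the graded domain `R` is homogeneous if `s I` is a homogeneous
integral ideal of `R` for some nonzero homogeneous element `s` of `R`. -/
def IsHomogeneousFractional (I : FractionalIdeal R⁰ K) : Prop :=
  ∃ s : R, s ≠ 0 ∧ SetLike.IsHomogeneousElem 𝒜 s ∧
    ∃ J : Ideal R, J.IsHomogeneous 𝒜 ∧
      FractionalIdeal.spanSingleton R⁰ (algebraMap R K s) * I = J

variable {𝒜}

theorem isHomogeneous_span_singleton {s : R} (hs : SetLike.IsHomogeneousElem 𝒜 s) :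
    (Ideal.span {s}).IsHomogeneous 𝒜 :=
  Ideal.homogeneous_span 𝒜 _ (by simpa using hs)

theorem mem_iff_of_spanSingleton_mul_eq {I : FractionalIdeal R⁰ K} {J : Ideal R} {s : K}
    (h : FractionalIdeal.spanSingleton R⁰ s * I = J) {r : R} :
    r ∈ J ↔ ∃ y ∈ I, s * y = algebraMap R K r := by
  have h2 : r ∈ J ↔ algebraMap R K r ∈ (J : FractionalIdeal R⁰ K) := by
    rw [FractionalIdeal.mem_coeIdeal]
    exact ⟨fun hr => ⟨r, hr, rfl⟩, fun ⟨r', hr', e⟩ => IsFractionRing.injective R K e ▸ hr'⟩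
  rw [h2, ← h, FractionalIdeal.mem_singleton_mul]
  simp only [eq_comm]

theorem IsHomogeneousFractional.exists_component {I : FractionalIdeal R⁰ K}
    (hI : IsHomogeneousFractional 𝒜 I) {t : R} (ht : SetLike.IsHomogeneousElem 𝒜 t)
    {x : K} (hx : x ∈ I) {r : R} (hr : algebraMap R K t * x = algebraMap R K r) (i : ι) :
    ∃ y ∈ I, algebraMap R K t * y = algebraMap R K (DirectSum.decompose 𝒜 r i) := by
  obtain ⟨s, hs0, ⟨d, hs⟩, J, hJ, h⟩ := hI
  have hs0' : algebraMap R K s ≠ 0 := (map_ne_zero_iff _ (IsFractionRing.injective R K)).2 hs0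
  obtain ⟨r', hr', e⟩ : ∃ r' ∈ J, algebraMap R K r' = algebraMap R K s * x := by
    rw [← FractionalIdeal.mem_coeIdeal R⁰, ← h]
    exact FractionalIdeal.mem_singleton_mul.2 ⟨x, hx, rfl⟩
  have e2 : s * r = t * r' := by
    apply IsFractionRing.injective R K
    rw [map_mul, map_mul, ← hr, e]
    ring
  have hmem : s * r ∈ Ideal.span {t} * J := by
    rw [e2]; exact Ideal.mem_span_singleton_mul.2 ⟨r', hr', rfl⟩
  have := ((isHomogeneous_span_singleton ht).mul hJ) (d + i) hmem
  rw [DirectSum.coe_decompose_mul_add_of_left_mem 𝒜 hs] at this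
  obtain ⟨w, hw, hw'⟩ := Ideal.mem_span_singleton_mul.1 this
  obtain ⟨y, hy, hy'⟩ := (mem_iff_of_spanSingleton_mul_eq h).1 hw
  refine ⟨y, hy, ?_⟩
  apply mul_left_cancel₀ hs0'
  rw [← map_mul, ← hw', map_mul, ← hy']
  ring

theorem IsHomogeneousFractional.of_components {I : FractionalIdeal R⁰ K} {s : R} (hs0 : s ≠ 0)
    (hs : SetLike.IsHomogeneousElem 𝒜 s)
    (h1 : ∀ x ∈ I, ∃ r : R, algebraMap R K s * x = algebraMap R K r)
    (h2 : ∀ x ∈ I, ∀ r : R, algebraMap R K s * x = algebraMap R K r → ∀ i,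
      ∃ y ∈ I, algebraMap R K s * y = algebraMap R K (DirectSum.decompose 𝒜 r i)) :
    IsHomogeneousFractional 𝒜 I := by
  obtain ⟨J, hJ⟩ : ∃ J : Ideal R, (J : FractionalIdeal R⁰ K) =
      FractionalIdeal.spanSingleton R⁰ (algebraMap R K s) * I := by
    rw [← FractionalIdeal.le_one_iff_exists_coeIdeal, FractionalIdeal.spanSingleton_mul_le_iff]
    intro x hx
    obtain ⟨r, hr⟩ := h1 x hx
    rw [hr]
    exact FractionalIdeal.coe_mem_one _ r
  refine ⟨s, hs0, hs, J, fun i r hr => ?_, hJ.symm⟩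
  obtain ⟨x, hx, e⟩ := (mem_iff_of_spanSingleton_mul_eq hJ.symm).1 hr
  exact (mem_iff_of_spanSingleton_mul_eq hJ.symm).2 (h2 x hx r e i)

theorem IsHomogeneousFractional.coeIdeal {J : Ideal R} (hJ : J.IsHomogeneous 𝒜) :
    IsHomogeneousFractional 𝒜 (J : FractionalIdeal R⁰ K) :=
  ⟨1, one_ne_zero, ⟨0, SetLike.GradedOne.one_mem⟩, J, hJ, by simp⟩

theorem IsHomogeneousFractional.one : IsHomogeneousFractional 𝒜 (1 : FractionalIdeal R⁰ K) := by
  rw [← FractionalIdeal.coeIdeal_top]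
  exact .coeIdeal (Ideal.IsHomogeneous.top 𝒜)

theorem IsHomogeneousFractional.mul {I J : FractionalIdeal R⁰ K}
    (hI : IsHomogeneousFractional 𝒜 I) (hJ : IsHomogeneousFractional 𝒜 J) :
    IsHomogeneousFractional 𝒜 (I * J) := by
  obtain ⟨s, hs0, hs, A, hA, hsA⟩ := hI
  obtain ⟨t, ht0, ht, B, hB, htB⟩ := hJ
  refine ⟨s * t, mul_ne_zero hs0 ht0, SetLike.IsHomogeneousElem.mul hs ht, A * B, hA.mul hB, ?_⟩
  rw [FractionalIdeal.coeIdeal_mul, ← hsA, ← htB, map_mul,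
    ← FractionalIdeal.spanSingleton_mul_spanSingleton]
  exact mul_mul_mul_comm _ _ _ _

theorem IsHomogeneousFractional.one_div {I : FractionalIdeal R⁰ K}
    (hI : IsHomogeneousFractional 𝒜 I) : IsHomogeneousFractional 𝒜 (1 / I) := by
  classical
  by_cases hI0 : I = 0
  · rw [hI0, FractionalIdeal.div_zero, ← FractionalIdeal.coeIdeal_bot]
    exact .coeIdeal (Ideal.IsHomogeneous.bot 𝒜)
  have hI' := hI
  obtain ⟨s, hs0, hs, J, hJ, h⟩ := hI
  have hinj := IsFractionRing.injective R K
  have hs0' : algebraMap R K s ≠ 0 := (map_ne_zero_iff _ hinj).2 hs0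
  obtain ⟨x, hx, hx0⟩ := (Submodule.ne_bot_iff _).1 (FractionalIdeal.coeToSubmodule_ne_bot.2 hI0)
  have hint : ∀ w ∈ I, ∃ v : R, algebraMap R K s * w = algebraMap R K v := by
    intro w hw
    obtain ⟨v, _, hv⟩ := (FractionalIdeal.mem_coeIdeal R⁰).1
      (h ▸ FractionalIdeal.mem_singleton_mul.2 ⟨w, hw, rfl⟩)
    exact ⟨v, hv.symm⟩
  obtain ⟨r, hr⟩ := hint x hx
  have hr0 : r ≠ 0 := by
    rintro rfl
    rw [map_zero] at hr
    exact mul_ne_zero hs0' hx0 hr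
  obtain ⟨i, hi⟩ : ∃ i, (DirectSum.decompose 𝒜 r i : R) ≠ 0 := by
    by_contra! hall
    apply hr0
    rw [← DirectSum.sum_support_decompose 𝒜 r]
    exact Finset.sum_eq_zero fun i _ => hall i
  obtain ⟨y, hy, hyq⟩ := hI'.exists_component hs hx hr i
  set q : R := (DirectSum.decompose 𝒜 r i : R) with hq
  have hqh : q ∈ 𝒜 i := (DirectSum.decompose 𝒜 r i).2
  have hq0' : algebraMap R K q ≠ 0 := (map_ne_zero_iff _ hinj).2 hi
  have hmem : ∀ z : K, z ∈ 1 / I ↔ ∀ w ∈ I, ∃ m : R, algebraMap R K m = z * w := fun z => by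
    rw [FractionalIdeal.mem_div_iff_of_ne_zero hI0]
    simp only [FractionalIdeal.mem_one_iff]
  refine .of_components hi ⟨i, hqh⟩ (fun z hz => ?_) (fun z hz p hp j => ?_)
  · obtain ⟨m, hm⟩ := (hmem z).1 hz y hy
    refine ⟨s * m, ?_⟩
    rw [← hyq, map_mul, hm]
    ring
  · refine ⟨algebraMap R K (DirectSum.decompose 𝒜 p j) / algebraMap R K q, ?_,
      mul_div_cancel₀ _ hq0'⟩
    rw [hmem]
    intro w hw
    obtain ⟨v, hv⟩ := hint w hw
    have key : (DirectSum.decompose 𝒜 p j : R) * v ∈ Ideal.span {q * s} := by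
      rw [← DirectSum.sum_support_decompose 𝒜 v, Finset.mul_sum]
      refine Ideal.sum_mem _ fun k _ => ?_
      obtain ⟨w', hw', e⟩ := hI'.exists_component hs hw hv k
      have hk : (DirectSum.decompose 𝒜 v k : R) ∈ 𝒜 k := (DirectSum.decompose 𝒜 v k).2
      obtain ⟨m, hm⟩ := (hmem z).1 hz w' hw'
      have : p * (DirectSum.decompose 𝒜 v k : R) ∈ Ideal.span {q * s} := by
        refine Ideal.mem_span_singleton'.2 ⟨m, hinj ?_⟩
        rw [map_mul, map_mul, map_mul, hm, ← hp, ← e]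
        ring
      have h3 := isHomogeneous_span_singleton
        (SetLike.IsHomogeneousElem.mul ⟨i, hqh⟩ hs) (j + k) this
      rwa [DirectSum.coe_decompose_mul_add_of_right_mem 𝒜 hk] at h3
    obtain ⟨m, hm⟩ := Ideal.mem_span_singleton'.1 key
    refine ⟨m, mul_left_cancel₀ (mul_ne_zero hq0' hs0') ?_⟩
    have := congrArg (algebraMap R K) hm
    rw [map_mul, map_mul, map_mul, ← hv] at this
    rw [mul_comm _ (algebraMap R K m), this]
    field_simp

theorem IsHomogeneousFractional.tClosure {I : FractionalIdeal R⁰ K}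
    (hI : IsHomogeneousFractional 𝒜 I) : IsHomogeneousFractional 𝒜 (tClosure I) := by
  have hI' := hI
  obtain ⟨s, hs0, hs, J, hJ, h⟩ := hI
  have hs0' : algebraMap R K s ≠ 0 :=
    (map_ne_zero_iff _ (IsFractionRing.injective R K)).2 hs0
  refine .of_components hs0 hs (fun x hx => ?_) (fun x hx r hr i => ?_)
  · have h1 : algebraMap R K s * x ∈ vClosure (1 : FractionalIdeal R⁰ K) := by
      have := mul_mem_vClosure (algebraMap R K s) (tClosure_le_vClosure I hx)
      rw [h] at this
      exact vClosure_mono FractionalIdeal.coeIdeal_le_one this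
    rw [vClosure, FractionalIdeal.div_one, FractionalIdeal.div_one,
      FractionalIdeal.mem_one_iff] at h1
    obtain ⟨r, hr⟩ := h1
    exact ⟨r, hr.symm⟩
  · obtain ⟨F, hF, hf, hx⟩ := hx
    obtain ⟨G, hG, hg, hGh, hFG⟩ : ∃ G ≤ I, (G : Submodule R K).FG ∧
        IsHomogeneousFractional 𝒜 G ∧ F ≤ G := by
      have hle : FractionalIdeal.spanSingleton R⁰ (algebraMap R K s) * F ≤
          (J : FractionalIdeal R⁰ K) := h ▸ mul_le_mul_right hF _
      obtain ⟨A, hA⟩ := FractionalIdeal.le_one_iff_exists_coeIdeal.1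
        (hle.trans FractionalIdeal.coeIdeal_le_one)
      have hAJ : A ≤ J := (FractionalIdeal.coeIdeal_le_coeIdeal K).1 (hA ▸ hle)
      have hAfg : A.FG := by
        rw [← FractionalIdeal.coeIdeal_fg R⁰ (IsFractionRing.injective R K), hA,
          FractionalIdeal.coe_mul, FractionalIdeal.coe_spanSingleton]
        exact (Submodule.fg_span_singleton _).mul hf
      classical
      obtain ⟨T, hT⟩ := hAfg
      set U : Finset R := T.biUnion fun a =>
        (DirectSum.decompose 𝒜 a).support.image fun i => (DirectSum.decompose 𝒜 a i : R) with hU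
      have hBh : (Ideal.span (U : Set R)).IsHomogeneous 𝒜 := by
        refine Ideal.homogeneous_span 𝒜 _ fun u hu => ?_
        simp only [hU, Finset.coe_biUnion, Set.mem_iUnion, Finset.coe_image, Set.mem_image] at hu
        obtain ⟨a, _, i, _, rfl⟩ := hu
        exact ⟨i, (DirectSum.decompose 𝒜 a i).2⟩
      have hBJ : Ideal.span (U : Set R) ≤ J := by
        refine Ideal.span_le.2 fun u hu => ?_
        simp only [hU, Finset.coe_biUnion, Set.mem_iUnion, Finset.coe_image, Set.mem_image] at hu
        obtain ⟨a, ha, i, _, rfl⟩ := hu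
        exact hJ i (hAJ (hT ▸ Submodule.subset_span ha))
      have hAB : A ≤ Ideal.span (U : Set R) := by
        rw [← hT]
        refine Submodule.span_le.2 fun a ha => ?_
        rw [← DirectSum.sum_support_decompose 𝒜 a]
        refine Ideal.sum_mem _ fun i hi => Ideal.subset_span ?_
        simp only [hU, Finset.coe_biUnion, Set.mem_iUnion, Finset.coe_image, Set.mem_image]
        exact ⟨a, ha, i, hi, rfl⟩
      have hc : ∀ H : FractionalIdeal R⁰ K,
          FractionalIdeal.spanSingleton R⁰ (algebraMap R K s)⁻¹ *
            (FractionalIdeal.spanSingleton R⁰ (algebraMap R K s) * H) = H := fun H => by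
        rw [← mul_assoc, FractionalIdeal.spanSingleton_mul_spanSingleton, inv_mul_cancel₀ hs0',
          FractionalIdeal.spanSingleton_one, one_mul]
      refine ⟨FractionalIdeal.spanSingleton R⁰ (algebraMap R K s)⁻¹ *
        (Ideal.span (U : Set R) : Ideal R), ?_, ?_, ⟨s, hs0, hs, _, hBh, ?_⟩, ?_⟩
      · rw [← hc I, h]
        exact mul_le_mul_right ((FractionalIdeal.coeIdeal_le_coeIdeal K).2 hBJ) _
      · rw [FractionalIdeal.coe_mul, FractionalIdeal.coe_spanSingleton]
        refine (Submodule.fg_span_singleton _).mul ?_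
        exact (FractionalIdeal.coeIdeal_fg R⁰ (IsFractionRing.injective R K) _).2 ⟨U, rfl⟩
      · rw [← mul_assoc, FractionalIdeal.spanSingleton_mul_spanSingleton, mul_inv_cancel₀ hs0',
          FractionalIdeal.spanSingleton_one, one_mul]
      · rw [← hc F, ← hA]
        exact mul_le_mul_right ((FractionalIdeal.coeIdeal_le_coeIdeal K).2 hAB) _
    obtain ⟨y, hy, e⟩ := hGh.one_div.one_div.exists_component hs (vClosure_mono hFG hx) hr i
    exact ⟨y, ⟨G, hG, hg, hy⟩, e⟩

end Homogeneous

section HomogeneousClassGroup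

variable {ι σ R : Type*} [DecidableEq ι] [AddCancelCommMonoid ι] [CommRing R] [IsDomain R]
  [SetLike σ R] [AddSubmonoidClass σ R] (𝒜 : ι → σ) [GradedRing 𝒜]

/-- The group `HT(R)` of homogeneous `t`-invertible fractional `t`-ideals of the graded
domain `R`. -/
noncomputable def HT : Subgroup (TInvertible R) where
  carrier := {u | IsHomogeneousFractional 𝒜 u.val.val}
  mul_mem' {u v} hu hv := by
    change IsHomogeneousFractional 𝒜 (tClosure (u.val.val * v.val.val))
    exact (IsHomogeneousFractional.mul hu hv).tClosure
  one_mem' := IsHomogeneousFractional.one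
  inv_mem' {u} hu := by
    change IsHomogeneousFractional 𝒜 (u⁻¹ : TInvertible R).val.val
    rw [TInvertible.val_inv]
    exact IsHomogeneousFractional.one_div hu

/-- The homogeneous class group `HCl(R) = HT(R) / HP(R)`, with `HP(R) = HT(R) ∩ P(R)` the group of
principal homogeneous fractional ideals, as a subgroup of `Cl(R)`: the classes of the homogeneous
`t`-invertible fractional `t`-ideals. -/
noncomputable def HCl : Subgroup (Cl R) :=
  (HT 𝒜).map (QuotientGroup.mk' (principal R).range)

end HomogeneousClassGroup

section Composite

open Polynomial

variable {B : Type*} [CommRing B]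

/-- The ring `A + X B[X]`, as a subring of `B[X]`, for a subring `A` of `B`. -/
noncomputable def composite (A : Subring B) : Subring B[X] where
  carrier := {p | ∃ a ∈ A, ∃ q : B[X], p = C a + X * q}
  mul_mem' := by
    rintro _ _ ⟨a, ha, p, rfl⟩ ⟨b, hb, q, rfl⟩
    exact ⟨a * b, A.mul_mem ha hb, C a * q + C b * p + X * p * q, by rw [C_mul]; ring⟩
  one_mem' := ⟨1, A.one_mem, 0, by simp⟩
  add_mem' := by
    rintro _ _ ⟨a, ha, p, rfl⟩ ⟨b, hb, q, rfl⟩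
    exact ⟨a + b, A.add_mem ha hb, p + q, by rw [C_add]; ring⟩
  zero_mem' := ⟨0, A.zero_mem, 0, by simp⟩
  neg_mem' := by
    rintro _ ⟨a, ha, p, rfl⟩
    exact ⟨-a, A.neg_mem ha, -p, by rw [C_neg]; ring⟩

theorem mem_composite {A : Subring B} {p : B[X]} : p ∈ composite A ↔ p.coeff 0 ∈ A := by
  constructor
  · rintro ⟨a, ha, q, rfl⟩
    simpa using ha
  · exact fun h => ⟨p.coeff 0, h, p.divX, by rw [add_comm, X_mul_divX_add]⟩

/-- The homogeneous elements `b X ^ n` of degree `n` of `A + X B[X]`, in its natural grading. -/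
noncomputable def compositeGrading (A : Subring B) (n : ℕ) : AddSubgroup (composite A) where
  carrier := {p | ∃ b : B, (p : B[X]) = C b * X ^ n}
  add_mem' := by
    rintro p q ⟨a, ha⟩ ⟨b, hb⟩
    exact ⟨a + b, by rw [Subring.coe_add, ha, hb, C_add, add_mul]⟩
  zero_mem' := ⟨0, by simp⟩
  neg_mem' := by
    rintro p ⟨a, ha⟩
    exact ⟨-a, by rw [Subring.coe_neg, ha, C_neg, neg_mul]⟩

/-- The degree `n` part of an element of `A + X B[X]`. -/
noncomputable def compositeComponent (A : Subring B) (n : ℕ) : composite A →+ compositeGrading A n where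
  toFun p := ⟨⟨C ((p : B[X]).coeff n) * X ^ n, mem_composite.2 (by
    have := mem_composite.1 p.2
    rcases n with _ | n
    · simpa using this
    · simp [coeff_X_pow, A.zero_mem])⟩, _, rfl⟩
  map_zero' := by ext; simp
  map_add' p q := by ext; simp [add_mul]

theorem compositeComponent_apply (A : Subring B) (n : ℕ) (p : composite A) :
    ((compositeComponent A n p : composite A) : B[X]) = C ((p : B[X]).coeff n) * X ^ n := rfl

instance (A : Subring B) : SetLike.GradedMonoid (compositeGrading A) where
  one_mem := ⟨1, by simp⟩
  mul_mem := by
    rintro i j p q ⟨a, ha⟩ ⟨b, hb⟩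
    exact ⟨a * b, by rw [Subring.coe_mul, ha, hb, C_mul, pow_add]; ring⟩

theorem compositeComponent_of_mem (A : Subring B) {i : ℕ} (n : ℕ) (x : compositeGrading A i) :
    compositeComponent A n (x : composite A) =
      DirectSum.of (fun i => compositeGrading A i) i x n := by
  obtain ⟨x, b, hb⟩ := x
  by_cases h : i = n
  · subst h
    rw [DirectSum.of_eq_same]
    ext1; ext1
    rw [compositeComponent_apply, hb]
    simp
  · rw [DirectSum.of_eq_of_ne _ _ _ (Ne.symm h)]
    ext1; ext1
    rw [compositeComponent_apply, hb]
    simp [coeff_X_pow, Ne.symm h]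

theorem coe_compositeComponent_of_mem (A : Subring B) (n : ℕ)
    (x : DirectSum ℕ fun i => compositeGrading A i) :
    compositeComponent A n (DirectSum.coeAddMonoidHom (compositeGrading A) x) = x n := by
  induction x using DirectSum.induction_on with
  | zero => simp
  | of i x => rw [DirectSum.coeAddMonoidHom_of]; exact compositeComponent_of_mem A n x
  | add x y hx hy => rw [map_add, map_add, hx, hy]; rfl

theorem mk_compositeComponent_apply (A : Subring B) (p : composite A) (n : ℕ) :
    DirectSum.mk (fun i => compositeGrading A i) (p : B[X]).support
      (fun i => compositeComponent A i p) n = compositeComponent A n p := by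
  by_cases hn : n ∈ (p : B[X]).support
  · exact DirectSum.mk_apply_of_mem hn
  · rw [DirectSum.mk_apply_of_notMem hn]
    ext1; ext1
    rw [compositeComponent_apply, notMem_support_iff.1 hn]
    simp

/-- The natural grading of `A + X B[X]` by degree. -/
noncomputable instance (A : Subring B) : GradedRing (compositeGrading A) where
  decompose' p := DirectSum.mk (fun i => compositeGrading A i) (p : B[X]).support
    fun i => compositeComponent A i p
  left_inv p := by
    ext n
    have h := coe_compositeComponent_of_mem A n (DirectSum.mk (fun i => compositeGrading A i)
      (p : B[X]).support fun i => compositeComponent A i p)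
    rw [mk_compositeComponent_apply] at h
    have h2 := congrArg (fun y : compositeGrading A n => ((y : composite A) : B[X]).coeff n) h
    simpa [compositeComponent_apply] using h2
  right_inv x := by
    ext1 n
    rw [mk_compositeComponent_apply]
    exact coe_compositeComponent_of_mem A n x

end Composite

end GradedDomain

/-!
Write `R = A + X B[X]`, and let `L` be the quotient field of `B`. Inverting the nonzero homogeneous
elements of `R` gives `L[X, X⁻¹]`, a principal ideal domain.

Suppose that `B` is integrally closed. A `t`-invertible `t`-ideal `I` has the same inverse as some
finitely generated `J ⊆ I` (`TInvertible.exists_fg`), and `J` becomes principal in `L[X, X⁻¹]`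
(`exists_dvd_homogeneous_mul`). So a multiple of `I` is integral and contains a nonzero homogeneous
element `s`. Such a `t`-ideal is homogeneous (`isHomogeneousFractional_of_mem`): if `s` divides
`f g`, then `s` divides `f_i g` for every component `f_i` of `f` (`dvd_decompose_mul`). For the
coefficients this is the classical fact that a constant dividing all coefficients of `f g` divides
each product of a coefficient of `f` and one of `g` (`Polynomial.dvd_coeff_mul_coeff`), proved by
the Gauss lemma in the valuation rings above `B`. The subring `A` enters only through the lowest
coefficient of `f g`, which is a single such product.

Suppose that `u ∈ L` is integral over `B` but not in `B`. The reverse `g` of a monic polynomial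
vanishing at `u` has constant term `1` and factors over `L` as `h q`, with `h = 1 - u X` not in
`B[X]` and `q` of constant term `1`. If `b` is a common denominator of `h` and `q`, then the product
of `(q, b X)` and `(h, b X)` lies in `R` and contains `g` and `b² X²`, and `(g, b² X²)_v = R`. So
`(q, b X)_t` is a `t`-invertible `t`-ideal. It generates the unit ideal of `L[X, X⁻¹]`, so a
multiple of it can be homogeneous only if it is itself closed under components. Then it contains
the constant term `1` of `q`, and multiplying by `h` gives `h ∈ R`, a contradiction. The proof of
`isIntegrallyClosed_of_HCl_eq_top` scales these ideals by `b X`, which places them inside `R`.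
-/

/-! ### Products of polynomials and divisibility of coefficients -/

namespace Polynomial

/-- A nonzero polynomial has a first coefficient of maximal valuation. -/
theorem exists_min_index_max_valuation {L Γ : Type*} [Field L]
    [LinearOrderedCommGroupWithZero Γ] (v : Valuation L Γ) {p : L[X]} (hp : p ≠ 0) :
    ∃ i, p.coeff i ≠ 0 ∧ (∀ j, v (p.coeff j) ≤ v (p.coeff i)) ∧
      ∀ j < i, v (p.coeff j) < v (p.coeff i) := by
  classical
  have hex : ∃ i, ∀ j, v (p.coeff j) ≤ v (p.coeff i) := by
    obtain ⟨i, _, hi⟩ := p.support.exists_max_image (fun i => v (p.coeff i))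
      (nonempty_support_iff.2 hp)
    refine ⟨i, fun j => ?_⟩
    by_cases hj : j ∈ p.support
    · exact hi j hj
    · rw [notMem_support_iff.1 hj, map_zero]; exact zero_le
  refine ⟨Nat.find hex, fun h0 => ?_, Nat.find_spec hex, fun j hj => ?_⟩
  · have h := Nat.find_spec hex p.natDegree
    rw [h0, map_zero, le_zero_iff, map_eq_zero] at h
    exact hp (leadingCoeff_eq_zero.1 h)
  · have := Nat.find_min hex hj
    push Not at this
    obtain ⟨k, hk⟩ := this
    exact hk.trans_le (Nat.find_spec hex k)

/-- The Gauss lemma for an arbitrary valuation: the product of the maximal valuations of the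
coefficients of `p` and `q` is attained by a coefficient of `p * q`. -/
theorem valuation_coeff_mul_coeff_le {L Γ : Type*} [Field L]
    [LinearOrderedCommGroupWithZero Γ] (v : Valuation L Γ) {p q : L[X]} {c : Γ}
    (h : ∀ k, v ((p * q).coeff k) ≤ c) (i j : ℕ) : v (p.coeff i * q.coeff j) ≤ c := by
  by_cases hp : p = 0
  · simp [hp]
  by_cases hq : q = 0
  · simp [hq]
  obtain ⟨m, hm0, hm, hm'⟩ := exists_min_index_max_valuation v hp
  obtain ⟨n, hn0, hn, hn'⟩ := exists_min_index_max_valuation v hq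
  have hpos : 0 < v (p.coeff m) := zero_lt_iff.2 ((_root_.map_ne_zero v).2 hm0)
  have hpos' : 0 < v (q.coeff n) := zero_lt_iff.2 ((_root_.map_ne_zero v).2 hn0)
  have hmn : v ((p * q).coeff (m + n)) = v (p.coeff m * q.coeff n) := by
    rw [coeff_mul, ← Finset.add_sum_erase _ _
      (show (m, n) ∈ Finset.HasAntidiagonal.antidiagonal (m + n) from
        Finset.HasAntidiagonal.mem_antidiagonal.2 rfl)]
    refine v.map_add_eq_of_lt_left (v.map_sum_lt ?_ ?_)
    · rw [map_mul]; exact (mul_pos hpos hpos').ne'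
    · rintro ⟨k, l⟩ hkl
      obtain ⟨hne, hkl⟩ := Finset.mem_erase.1 hkl
      rw [Finset.HasAntidiagonal.mem_antidiagonal] at hkl
      rw [map_mul, map_mul]
      rcases lt_or_ge k m with hk | hk
      · exact mul_lt_mul_of_lt_of_le_of_nonneg_of_pos (hm' k hk) (hn l) zero_le hpos'
      · have hl : l < n := by
          rcases hk.lt_or_eq with hk | rfl
          · dsimp only at hkl; omega
          · exact absurd (by rw [show l = n by dsimp only at hkl; omega]) hne
        rw [mul_comm, mul_comm (v (p.coeff m))]
        exact mul_lt_mul_of_lt_of_le_of_nonneg_of_pos (hn' l hl) (hm k) zero_le hpos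
  calc v (p.coeff i * q.coeff j) ≤ v (p.coeff m * q.coeff n) := by
        rw [map_mul, map_mul]; exact mul_le_mul' (hm i) (hn j)
    _ ≤ c := hmn ▸ h _

/-- Over an integrally closed domain, a constant dividing every coefficient of `f * g` divides
every product of a coefficient of `f` and a coefficient of `g`: this holds in every valuation
ring above the domain, and the domain is the intersection of these. -/
theorem dvd_coeff_mul_coeff {B : Type*} [CommRing B] [IsDomain B] [IsIntegrallyClosed B]
    {f g : B[X]} {b : B} (h : ∀ k, b ∣ (f * g).coeff k) (i j : ℕ) :
    b ∣ f.coeff i * g.coeff j := by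
  by_cases hb : b = 0
  · subst hb
    have hfg : f * g = 0 := by
      ext k
      simpa using h k
    rcases mul_eq_zero.1 hfg with rfl | rfl <;> simp
  set L := FractionRing B
  set φ := algebraMap B L
  have hinj : Function.Injective φ := IsFractionRing.injective B L
  have hb' : φ b ≠ 0 := (map_ne_zero_iff _ hinj).2 hb
  have : IsIntegrallyClosedIn φ.range L := by
    refine isIntegrallyClosedIn_iff.2 ⟨Subtype.val_injective, fun {x} hx => ?_⟩
    have hx' : IsIntegral B x := by
      obtain ⟨p, hp, hpx⟩ := hx
      obtain ⟨p', hp', -, hp'm⟩ := lifts_and_natDegree_eq_and_monic (f := φ.rangeRestrict)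
        (p := p) ((mem_lifts p).2 (map_surjective _ φ.rangeRestrict_surjective p)) hp
      refine ⟨p', hp'm, ?_⟩
      rw [← hp', eval₂_map] at hpx
      exact hpx
    obtain ⟨y, hy⟩ := IsIntegrallyClosed.isIntegral_iff.1 hx'
    exact ⟨⟨x, y, hy⟩, rfl⟩
  have hmem : φ (f.coeff i * g.coeff j) / φ b ∈ φ.range := by
    rw [Subring.eq_iInf_of_isIntegrallyClosedIn (R := φ.range), Subring.mem_iInf]
    rintro ⟨V, hV⟩
    change _ ∈ V
    rw [← V.valuation_le_one_iff, map_div₀,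
      div_le_one₀ (zero_lt_iff.2 ((_root_.map_ne_zero V.valuation).2 hb')), map_mul, ← coeff_map,
      ← coeff_map]
    refine valuation_coeff_mul_coeff_le V.valuation (fun k => ?_) i j
    obtain ⟨d, hd⟩ := h k
    rw [← Polynomial.map_mul, coeff_map, hd, map_mul, map_mul]
    exact mul_le_of_le_one_right' ((V.valuation_le_one_iff _).2 (hV ⟨d, rfl⟩))
  obtain ⟨d, hd⟩ := hmem
  refine ⟨d, hinj ?_⟩
  rw [map_mul φ b d, hd, mul_div_cancel₀ _ hb']

/-- If `u = a / b` is integral over `B` but not in `B`, then `1 - u X` divides, over the quotient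
field, the reverse `g` of a monic polynomial that vanishes at `u`. After clearing denominators,
the factorization of `g` takes the form below. -/
theorem exists_mul_eq_of_not_isIntegrallyClosed {B : Type*} [CommRing B] [IsDomain B]
    (hB : ¬ IsIntegrallyClosed B) :
    ∃ (b : B) (H Q g : B[X]), b ≠ 0 ∧ Q.coeff 0 = b ∧ H * Q = C (b ^ 2) * g ∧
      g.coeff 0 = 1 ∧ ¬ C b ∣ H := by
  set L := FractionRing B
  have hinj : Function.Injective (algebraMap B L) := IsFractionRing.injective B L
  obtain ⟨u, hu, hu'⟩ : ∃ u : L, IsIntegral B u ∧ ∀ y, algebraMap B L y ≠ u := by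
    by_contra! hcon
    exact hB ((isIntegrallyClosed_iff L).2 fun {x} hx => hcon x hx)
  obtain ⟨p, hp, hpu⟩ := hu
  obtain ⟨q, hq⟩ : (X - C u) ∣ p.map (algebraMap B L) := by
    rw [dvd_iff_isRoot, IsRoot, eval_map]
    exact hpu
  have hqm : q.leadingCoeff = 1 := by
    have := (hp.map (algebraMap B L)).leadingCoeff
    rw [hq, leadingCoeff_mul, leadingCoeff_X_sub_C, one_mul] at this
    exact this
  have hrev : p.reverse.map (algebraMap B L) = (X - C u).reverse * q.reverse := by
    rw [← reverse_mul_of_domain, ← hq]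
    ext n
    rw [coeff_map, coeff_reverse, coeff_reverse, coeff_map,
      natDegree_map_eq_of_injective hinj]
  have hint : ∀ r : L[X], ∃ d : B, d ≠ 0 ∧ ∃ r' : B[X],
      r'.map (algebraMap B L) = C (algebraMap B L d) * r := fun r => by
    obtain ⟨d, hd0, hd⟩ := IsLocalization.integerNormalization_spec (nonZeroDivisors B) r
    refine ⟨d, nonZeroDivisors.ne_zero hd0, _, hd.trans ?_⟩
    rw [← smul_eq_C_mul, algebraMap_smul]
  obtain ⟨d, hd0, H', hH⟩ := hint (X - C u).reverse
  obtain ⟨e, he0, Q', hQ⟩ := hint q.reverse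
  have hH' : (C e * H').map (algebraMap B L) = C (algebraMap B L (d * e)) * (X - C u).reverse := by
    rw [Polynomial.map_mul, hH, map_C, map_mul, map_mul]
    ring
  have hQ' : (C d * Q').map (algebraMap B L) = C (algebraMap B L (d * e)) * q.reverse := by
    rw [Polynomial.map_mul, hQ, map_C, map_mul, map_mul]
    ring
  refine ⟨d * e, C e * H', C d * Q', p.reverse, mul_ne_zero hd0 he0, ?_, ?_, ?_, ?_⟩
  · apply hinj
    rw [← coeff_map, hQ', coeff_C_mul, coeff_zero_reverse, hqm, mul_one]
  · apply map_injective _ hinj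
    rw [Polynomial.map_mul, hH', hQ', Polynomial.map_mul, hrev, map_C, map_pow, C_pow]
    ring
  · rw [coeff_zero_reverse, hp.leadingCoeff]
  · rintro ⟨r, hr⟩
    have hde : algebraMap B L (d * e) ≠ 0 := (map_ne_zero_iff _ hinj).2 (mul_ne_zero hd0 he0)
    rw [hr, Polynomial.map_mul, map_C] at hH'
    have h1 := congrArg (fun f => coeff f 1) (mul_left_cancel₀ (C_ne_zero.2 hde) hH')
    have h2 : ((X - C u).reverse).coeff 1 = - u := by
      rw [coeff_reverse, natDegree_X_sub_C, revAt_le le_rfl]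
      simp
    rw [h2, coeff_map] at h1
    exact hu' (-r.coeff 1) (by rw [map_neg, h1, neg_neg])

end Polynomial

/-! ### `t`-ideals: scaling, finite type, and homogeneity -/

namespace GradedDomain

open scoped nonZeroDivisors
open FractionalIdeal (spanSingleton)

section FiniteType

variable {R K : Type*} [CommRing R] [Field K] [Algebra R K] [IsFractionRing R K]

theorem exists_fg_le_mul {I J F : FractionalIdeal R⁰ K} (hF : F ≤ I * J)
    (hf : (F : Submodule R K).FG) :
    ∃ G ≤ I, (G : Submodule R K).FG ∧ F ≤ G * J := by
  classical
  have hone : ∀ x ∈ I * J, ∃ G ≤ I, (G : Submodule R K).FG ∧ x ∈ G * J := by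
    intro x hx
    refine FractionalIdeal.mul_induction_on hx (fun i hi j hj => ?_) fun x y hx hy => ?_
    · exact ⟨spanSingleton R⁰ i, FractionalIdeal.spanSingleton_le_iff_mem.2 hi,
        by rw [FractionalIdeal.coe_spanSingleton]; exact Submodule.fg_span_singleton i,
        FractionalIdeal.mul_mem_mul (FractionalIdeal.mem_spanSingleton_self _ i) hj⟩
    · obtain ⟨G, hG, hg, hx⟩ := hx
      obtain ⟨G', hG', hg', hy⟩ := hy
      exact ⟨G ⊔ G', sup_le hG hG', by rw [FractionalIdeal.coe_sup]; exact hg.sup hg',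
        ((G ⊔ G') * J).coeToSubmodule.add_mem (mul_le_mul_left le_sup_left J hx)
          (mul_le_mul_left le_sup_right J hy)⟩
  obtain ⟨s, hs⟩ := hf
  have hfin : ∀ s : Finset K, (∀ x ∈ s, x ∈ I * J) →
      ∃ G ≤ I, (G : Submodule R K).FG ∧ ∀ x ∈ s, x ∈ G * J := by
    intro s
    induction s using Finset.induction_on with
    | empty => exact fun _ => ⟨0, zero_le, by simpa using Submodule.fg_bot, by simp⟩
    | insert a s _ ih =>
      intro h
      obtain ⟨G, hG, hg, hx⟩ := ih fun x hx => h x (Finset.mem_insert_of_mem hx)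
      obtain ⟨G', hG', hg', hx'⟩ := hone a (h a (Finset.mem_insert_self a s))
      refine ⟨G ⊔ G', sup_le hG hG', ?_, fun x hxs => ?_⟩
      · rw [FractionalIdeal.coe_sup]; exact hg.sup hg'
      · rcases Finset.mem_insert.1 hxs with rfl | h
        · exact mul_le_mul_left le_sup_right J hx'
        · exact mul_le_mul_left le_sup_left J (hx x h)
  obtain ⟨G, hG, hg, hx⟩ := hfin s fun x hx => hF (by
    rw [← FractionalIdeal.mem_coe, ← hs]; exact Submodule.subset_span hx)
  refine ⟨G, hG, hg, ?_⟩
  have : (F : Submodule R K) ≤ (G * J : FractionalIdeal R⁰ K) := by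
    rw [← hs, Submodule.span_le]; exact hx
  exact this

end FiniteType

section Closure

variable {R K : Type*} [CommRing R] [IsDomain R] [Field K] [Algebra R K] [IsFractionRing R K]

theorem tClosure_spanSingleton_mul (x : K) (I : FractionalIdeal R⁰ K) :
    tClosure (spanSingleton R⁰ x * I) = spanSingleton R⁰ x * tClosure I := by
  by_cases hx : x = 0
  · rw [hx, FractionalIdeal.spanSingleton_zero, zero_mul, zero_mul,
      ← FractionalIdeal.spanSingleton_zero, tClosure_spanSingleton]
  have hle : ∀ (y : K) (J : FractionalIdeal R⁰ K),
      spanSingleton R⁰ y * tClosure J ≤ tClosure (spanSingleton R⁰ y * J) := fun y J => by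
    rw [mul_comm, mul_comm _ J]; exact tClosure_mul_le _ _
  refine le_antisymm ?_ (hle x I)
  have hinv : spanSingleton R⁰ x * spanSingleton R⁰ x⁻¹ = 1 := by
    rw [FractionalIdeal.spanSingleton_mul_spanSingleton, mul_inv_cancel₀ hx,
      FractionalIdeal.spanSingleton_one]
  calc tClosure (spanSingleton R⁰ x * I)
      = spanSingleton R⁰ x * (spanSingleton R⁰ x⁻¹ * tClosure (spanSingleton R⁰ x * I)) := by
        rw [← mul_assoc, hinv, one_mul]
    _ ≤ spanSingleton R⁰ x * tClosure (spanSingleton R⁰ x⁻¹ * (spanSingleton R⁰ x * I)) :=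
        mul_le_mul_right (hle _ _) _
    _ = spanSingleton R⁰ x * tClosure I := by
        rw [← mul_assoc (spanSingleton R⁰ x⁻¹), mul_comm (spanSingleton R⁰ x⁻¹), hinv, one_mul]

/-- An element sending `I` into a principal fractional ideal also sends `I_t` into it. -/
theorem mul_mem_spanSingleton_of_mem_tClosure {I : FractionalIdeal R⁰ K} {z c : K}
    (h : ∀ x ∈ I, z * x ∈ spanSingleton R⁰ c) {x : K} (hx : x ∈ tClosure I) :
    z * x ∈ spanSingleton R⁰ c := by
  rw [← tClosure_spanSingleton c]
  refine tClosure_mono (FractionalIdeal.spanSingleton_mul_le_iff.2 h) ?_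
  rw [tClosure_spanSingleton_mul]
  exact FractionalIdeal.mem_singleton_mul.2 ⟨x, hx, rfl⟩

end Closure

section TInvertible

variable {R : Type*} [CommRing R] [IsDomain R]

/-- A `t`-invertible `t`-ideal `I` is of finite type: it contains a finitely generated `J` with
`J⁻¹ = I⁻¹`. -/
theorem TInvertible.exists_fg (u : TInvertible R) :
    ∃ J ≤ u.val.val, J ≠ 0 ∧ (J : Submodule R (FractionRing R)).FG ∧
      ∀ z : FractionRing R, (∀ x ∈ J, z * x ∈ (1 : FractionalIdeal R⁰ (FractionRing R))) →
        ∀ x ∈ u.val.val, z * x ∈ (1 : FractionalIdeal R⁰ (FractionRing R)) := by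
  have h1 : tClosure (u.val.val * (u⁻¹ : TInvertible R).val.val) = 1 := by
    rw [← TIdeal.val_mul, Units.mul_inv, TIdeal.val_one]
  obtain ⟨F, hF, hf, hF1⟩ : (1 : FractionRing R) ∈
      tClosure (u.val.val * (u⁻¹ : TInvertible R).val.val) := by
    rw [h1]; exact FractionalIdeal.one_mem_one _
  obtain ⟨J, hJ, hj, hFJ⟩ := exists_fg_le_mul hF hf
  have hF0 : F ≠ 0 := by
    rintro rfl
    rw [vClosure_zero, FractionalIdeal.mem_zero_iff] at hF1
    exact one_ne_zero hF1
  have hJ0 : J ≠ 0 := by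
    rintro rfl
    rw [zero_mul] at hFJ
    exact hF0 (le_antisymm hFJ zero_le)
  refine ⟨J, hJ, hJ0, hj, fun z hz x hx => ?_⟩
  have key : ∀ y ∈ J * (u⁻¹ : TInvertible R).val.val,
      z * x * y ∈ (1 : FractionalIdeal R⁰ (FractionRing R)) := by
    intro y hy
    refine FractionalIdeal.mul_induction_on hy (fun i hi j hj => ?_) fun a b ha hb => ?_
    · have h2 : x * j ∈ (1 : FractionalIdeal R⁰ (FractionRing R)) :=
        h1 ▸ le_tClosure _ (FractionalIdeal.mul_mem_mul hx hj)
      have h3 := FractionalIdeal.mul_mem_mul (hz i hi) h2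
      rw [one_mul] at h3
      convert h3 using 1
      ring
    · rw [mul_add]
      exact (1 : FractionalIdeal R⁰ (FractionRing R)).coeToSubmodule.add_mem ha hb
  simpa using (mem_vClosure hF0).1 hF1 (z * x) fun y hy => key y (hFJ hy)

theorem principal_mul_val (x : (FractionRing R)ˣ) (u : TInvertible R) :
    (principal R x * u).val.val = spanSingleton R⁰ (x : FractionRing R) * u.val.val := by
  change tClosure (spanSingleton R⁰ (x : FractionRing R) * u.val.val) = _
  rw [tClosure_spanSingleton_mul, u.val.tClosure_eq]

theorem mk_mem_HCl {ι σ : Type*} [DecidableEq ι] [AddCancelCommMonoid ι]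
    [SetLike σ R] [AddSubmonoidClass σ R] {𝒜 : ι → σ} [GradedRing 𝒜] {u : TInvertible R} :
    (QuotientGroup.mk u : Cl R) ∈ HCl 𝒜 ↔ ∃ c : FractionRing R, c ≠ 0 ∧
      IsHomogeneousFractional 𝒜 (spanSingleton R⁰ c * u.val.val) := by
  constructor
  · rintro ⟨v, hv, hvu⟩
    obtain ⟨x, hx⟩ := QuotientGroup.eq.1 hvu.symm
    refine ⟨x, x.ne_zero, ?_⟩
    rw [← principal_mul_val, hx, mul_comm, mul_inv_cancel_left]
    exact hv
  · rintro ⟨c, hc, h⟩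
    refine ⟨principal R (Units.mk0 c hc) * u, ?_, ?_⟩
    · change IsHomogeneousFractional 𝒜 (principal R (Units.mk0 c hc) * u).val.val
      rw [principal_mul_val]
      exact h
    · refine QuotientGroup.eq.2 ⟨(Units.mk0 c hc)⁻¹, ?_⟩
      rw [map_inv, mul_inv, inv_mul_cancel_right]

/-- If the product of two fractional ideals has a nonzero principal `t`-closure, then the
`t`-closure of each of them is `t`-invertible. -/
theorem exists_tInvertible_of_tClosure_mul {F G : FractionalIdeal R⁰ (FractionRing R)}
    {c : FractionRing R} (hc : c ≠ 0) (h : tClosure (F * G) = spanSingleton R⁰ c) :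
    ∃ u : TInvertible R, u.val.val = tClosure F := by
  have hFG : F * G ≠ 0 := by
    intro h0
    rw [h0, ← FractionalIdeal.spanSingleton_zero, tClosure_spanSingleton] at h
    have := FractionalIdeal.mem_spanSingleton_self R⁰ c
    rw [← h, FractionalIdeal.spanSingleton_zero, FractionalIdeal.mem_zero_iff] at this
    exact hc this
  let a : TIdeal R := ⟨tClosure F, tClosure_ne_zero (left_ne_zero_of_mul hFG),
    tClosure_tClosure F⟩
  let b : TIdeal R := ⟨tClosure G, tClosure_ne_zero (right_ne_zero_of_mul hFG),
    tClosure_tClosure G⟩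
  have hab : a * b = (principal R (Units.mk0 c hc)).val := TIdeal.ext <| by
    rw [TIdeal.val_mul]
    change tClosure (tClosure F * tClosure G) = spanSingleton R⁰ c
    rw [tClosure_tClosure_mul, mul_comm, tClosure_tClosure_mul, mul_comm, h]
  have hu : IsUnit (a * b) := hab ▸ Units.isUnit _
  obtain ⟨u, hu⟩ := isUnit_of_mul_isUnit_left hu
  exact ⟨u, by rw [hu]⟩

end TInvertible

section Homogeneous

variable {ι σ R K : Type*} [DecidableEq ι] [AddCancelCommMonoid ι] [CommRing R] [IsDomain R]
  [SetLike σ R] [AddSubmonoidClass σ R] {𝒜 : ι → σ} [GradedRing 𝒜]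
  [Field K] [Algebra R K] [IsFractionRing R K]

/-- The divisibility hypothesis says that `(s, f)_v` contains the homogeneous components of `f`.
So an integral `t`-ideal containing `s` is homogeneous. -/
theorem isHomogeneousFractional_of_mem {I : FractionalIdeal R⁰ K} (hI : tClosure I = I)
    (hI1 : I ≤ 1) {s : R} (hs : s ≠ 0) (hsI : algebraMap R K s ∈ I)
    (hdvd : ∀ f g : R, s ∣ f * g → ∀ i, s ∣ (DirectSum.decompose 𝒜 f i : R) * g) :
    IsHomogeneousFractional 𝒜 I := by
  have hinj := IsFractionRing.injective R K
  have hs0 : algebraMap R K s ≠ 0 := (map_ne_zero_iff _ hinj).2 hs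
  refine .of_components one_ne_zero ⟨0, SetLike.GradedOne.one_mem⟩ (fun x hx => ?_)
    (fun x hx f hf i => ?_)
  · obtain ⟨r, hr⟩ := FractionalIdeal.mem_one_iff _ |>.1 (hI1 hx)
    exact ⟨r, by rw [map_one, one_mul, hr]⟩
  rw [map_one, one_mul] at hf
  refine ⟨algebraMap R K (DirectSum.decompose 𝒜 f i), ?_, by rw [map_one, one_mul]⟩
  rw [← hI]
  refine ⟨spanSingleton R⁰ (algebraMap R K s) ⊔ spanSingleton R⁰ x, ?_, ?_, ?_⟩
  · exact sup_le (FractionalIdeal.spanSingleton_le_iff_mem.2 hsI)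
      (FractionalIdeal.spanSingleton_le_iff_mem.2 hx)
  · rw [FractionalIdeal.coe_sup, FractionalIdeal.coe_spanSingleton,
      FractionalIdeal.coe_spanSingleton]
    exact (Submodule.fg_span_singleton _).sup (Submodule.fg_span_singleton _)
  have hmem : algebraMap R K s ∈
      spanSingleton R⁰ (algebraMap R K s) ⊔ spanSingleton R⁰ x :=
    (le_sup_left : spanSingleton R⁰ (algebraMap R K s) ≤ _)
      (FractionalIdeal.mem_spanSingleton_self _ _)
  have hmem' : x ∈ spanSingleton R⁰ (algebraMap R K s) ⊔ spanSingleton R⁰ x :=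
    (le_sup_right : spanSingleton R⁰ x ≤ _) (FractionalIdeal.mem_spanSingleton_self _ _)
  have hne : spanSingleton R⁰ (algebraMap R K s) ⊔ spanSingleton R⁰ x ≠ 0 := fun h0 => by
    rw [h0, FractionalIdeal.mem_zero_iff] at hmem
    exact hs0 hmem
  refine (mem_vClosure hne).2 fun z hz => ?_
  obtain ⟨g, hg⟩ := (FractionalIdeal.mem_one_iff _).1 (hz _ hmem)
  obtain ⟨g', hg'⟩ := (FractionalIdeal.mem_one_iff _).1 (hz _ hmem')
  obtain ⟨r, hr⟩ := hdvd f g ⟨g', hinj (by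
    rw [map_mul, map_mul, hg, hg', hf]
    ring)⟩ i
  refine (FractionalIdeal.mem_one_iff _).2 ⟨r, mul_left_cancel₀ hs0 ?_⟩
  rw [← map_mul, ← hr, map_mul, hg]
  ring

end Homogeneous

end GradedDomain

/-! ### Divisibility by homogeneous elements of `A + X B[X]` -/

namespace GradedDomain

open Polynomial
open scoped nonZeroDivisors
open FractionalIdeal (spanSingleton)

section Composite

variable {B : Type*} [CommRing B] {A : Subring B}

theorem coe_decompose_composite (p : composite A) (n : ℕ) :
    ((DirectSum.decompose (compositeGrading A) p n : composite A) : B[X]) =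
      C ((p : B[X]).coeff n) * X ^ n := by
  have h : DirectSum.decompose (compositeGrading A) p n = compositeComponent A n p :=
    mk_compositeComponent_apply A p n
  rw [h, compositeComponent_apply]

/-- The element `X p` of `A + X B[X]`, for any polynomial `p` over `B`. -/
noncomputable def compositeXMul (A : Subring B) (p : B[X]) : composite A :=
  ⟨X * p, mem_composite.2 (by rw [coeff_X_mul_zero]; exact A.zero_mem)⟩

theorem coe_compositeXMul (p : B[X]) : (compositeXMul A p : B[X]) = X * p := rfl

theorem isHomogeneousElem_of_coe_eq {s : composite A} {b : B} {n : ℕ}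
    (h : (s : B[X]) = C b * X ^ n) : SetLike.IsHomogeneousElem (compositeGrading A) s :=
  ⟨n, b, h⟩

theorem C_dvd_of_dvd_mul_of_coeff_zero_eq_one {β : B} {w g : B[X]} (hg : g.coeff 0 = 1)
    (h : C β ∣ w * g) : C β ∣ w := by
  rw [C_dvd_iff_dvd_coeff] at h ⊢
  intro k
  induction k using Nat.strong_induction_on with
  | _ k ih =>
    have hk := h k
    rw [coeff_mul, Finset.Nat.sum_antidiagonal_eq_sum_range_succ_mk, Finset.sum_range_succ,
      Nat.sub_self, hg, mul_one] at hk
    refine (dvd_add_right (Finset.dvd_sum fun j hj => ?_)).1 hk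
    exact (ih j (Finset.mem_range.1 hj)).mul_right _

variable [IsDomain B]

/-- Let `s = β X ^ n`. The coefficients of `f_i X ^ i * g` are multiples of `β` by
`dvd_coeff_mul_coeff`, but the lowest one must be a multiple by an element of `A`. As `X ^ n`
divides `f * g`, a nonzero `f_i g_j` with `i + j = n` is the product of the trailing coefficients,
so it is the degree `n` coefficient of `f * g`, which is `β` times an element of `A`. -/
theorem dvd_decompose_mul [IsIntegrallyClosed B] {s : composite A} (hs : s ≠ 0)
    (hsh : SetLike.IsHomogeneousElem (compositeGrading A) s) {f g : composite A}
    (hfg : s ∣ f * g) (i : ℕ) :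
    s ∣ (DirectSum.decompose (compositeGrading A) f i : composite A) * g := by
  obtain ⟨n, β, hsβ⟩ := hsh
  obtain ⟨r, hr⟩ := hfg
  have hβ : β ≠ 0 := by
    rintro rfl
    exact hs (Subtype.ext (by rw [hsβ, C_0, zero_mul]; rfl))
  have hr' : (f : B[X]) * (g : B[X]) = C β * X ^ n * (r : B[X]) := by
    rw [← hsβ, ← Subring.coe_mul, hr, Subring.coe_mul]
  have hdvd : ∀ j, β ∣ (f : B[X]).coeff i * (g : B[X]).coeff j := fun j => by
    refine dvd_coeff_mul_coeff (fun k => ?_) i j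
    rw [hr', mul_assoc, coeff_C_mul]
    exact dvd_mul_right _ _
  have hord : ∀ j, (f : B[X]).coeff i * (g : B[X]).coeff j ≠ 0 → n ≤ i + j ∧
      (i + j = n → (f : B[X]).coeff i * (g : B[X]).coeff j = β * (r : B[X]).coeff 0) := by
    intro j hij
    have hi := natTrailingDegree_le_of_ne_zero (left_ne_zero_of_mul hij)
    have hj := natTrailingDegree_le_of_ne_zero (right_ne_zero_of_mul hij)
    have hf : (f : B[X]) ≠ 0 := by
      intro h0; rw [h0, coeff_zero, zero_mul] at hij; exact hij rfl
    have hg : (g : B[X]) ≠ 0 := by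
      intro h0; rw [h0, coeff_zero, mul_zero] at hij; exact hij rfl
    have htop := coeff_mul_natTrailingDegree_add_natTrailingDegree (p := (f : B[X]))
      (q := (g : B[X]))
    have hn : n ≤ (f : B[X]).natTrailingDegree + (g : B[X]).natTrailingDegree := by
      by_contra hlt
      rw [hr', mul_assoc, coeff_C_mul, coeff_X_pow_mul', if_neg hlt, mul_zero] at htop
      exact mul_ne_zero (trailingCoeff_nonzero_iff_nonzero.2 hf)
        (trailingCoeff_nonzero_iff_nonzero.2 hg) htop.symm
    refine ⟨by omega, fun hijn => ?_⟩
    have hi' : i = (f : B[X]).natTrailingDegree := by omega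
    have hj' : j = (g : B[X]).natTrailingDegree := by omega
    rw [trailingCoeff, trailingCoeff, ← hi', ← hj', hijn, hr', mul_assoc, coeff_C_mul,
      coeff_X_pow_mul', if_pos le_rfl, Nat.sub_self] at htop
    exact htop.symm
  obtain ⟨p, hp⟩ : X ^ n ∣ C ((f : B[X]).coeff i) * X ^ i * (g : B[X]) := by
    refine X_pow_dvd_iff.2 fun k hk => ?_
    rw [mul_assoc, coeff_C_mul, coeff_X_pow_mul']
    split_ifs with hik
    · by_contra hne
      have := (hord _ hne).1
      omega
    · rw [mul_zero]
  have hpk : ∀ k, p.coeff k = if i ≤ k + n then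
      (f : B[X]).coeff i * (g : B[X]).coeff (k + n - i) else 0 := fun k => by
    rw [← coeff_X_pow_mul p n k, ← hp, mul_assoc, coeff_C_mul, coeff_X_pow_mul', mul_ite, mul_zero]
  obtain ⟨q, hq⟩ : C β ∣ p := by
    refine C_dvd_iff_dvd_coeff _ _ |>.2 fun k => ?_
    rw [hpk]
    split_ifs
    · exact hdvd _
    · exact dvd_zero _
  have hq0 : q.coeff 0 ∈ A := by
    have h0 := hpk 0
    rw [hq, coeff_C_mul, zero_add] at h0
    by_cases hz : q.coeff 0 = 0
    · rw [hz]; exact A.zero_mem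
    have hne := mul_ne_zero hβ hz
    rw [h0] at hne
    split_ifs at hne with hin
    · rw [if_pos hin, (hord _ hne).2 (by omega)] at h0
      rw [mul_left_cancel₀ hβ h0]
      exact mem_composite.1 r.2
    · exact absurd rfl hne
  refine ⟨⟨q, mem_composite.2 hq0⟩, Subtype.ext ?_⟩
  rw [Subring.coe_mul, Subring.coe_mul, coe_decompose_composite, hp, hq, hsβ]
  ring

theorem dvd_of_dvd_mul_of_coeff_zero_eq_one {s : composite A} (hs : s ≠ 0)
    (hsh : SetLike.IsHomogeneousElem (compositeGrading A) s) {w g : composite A}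
    (hg : (g : B[X]).coeff 0 = 1) (h : s ∣ w * g) : s ∣ w := by
  obtain ⟨n, β, hsβ⟩ := hsh
  obtain ⟨r, hr⟩ := h
  have hβ : β ≠ 0 := by
    rintro rfl
    exact hs (Subtype.ext (by rw [hsβ, C_0, zero_mul]; rfl))
  have hr' : (w : B[X]) * (g : B[X]) = X ^ n * (C β * (r : B[X])) := by
    rw [← mul_assoc, mul_comm (X ^ n), ← hsβ, ← Subring.coe_mul, hr, Subring.coe_mul]
  have hX : ¬ X ∣ (g : B[X]) := by
    rw [X_dvd_iff, hg]
    exact one_ne_zero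
  obtain ⟨w', hw'⟩ := prime_X.pow_dvd_of_dvd_mul_right n hX ⟨_, hr'⟩
  rw [hw', mul_assoc] at hr'
  have h1 := mul_left_cancel₀ (pow_ne_zero n X_ne_zero) hr'
  obtain ⟨q, hq⟩ := C_dvd_of_dvd_mul_of_coeff_zero_eq_one hg ⟨_, h1⟩
  rw [hq, mul_assoc] at h1
  have h2 := congrArg (fun p => coeff p 0) (mul_left_cancel₀ (C_ne_zero.2 hβ) h1)
  rw [mul_coeff_zero, hg, mul_one] at h2
  refine ⟨⟨q, mem_composite.2 (h2 ▸ mem_composite.1 r.2)⟩, Subtype.ext ?_⟩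
  rw [Subring.coe_mul, hsβ, hw', hq]
  ring

/-- A divisor of a nonzero monomial over a domain is a monomial. -/
theorem exists_eq_C_mul_X_pow_of_dvd {e : B[X]} {b : B} {n : ℕ} (hb : b ≠ 0)
    (h : e ∣ C b * X ^ n) : ∃ d m, e = C d * X ^ m := by
  obtain ⟨q, hq⟩ := h
  have h0 : C b * X ^ n ≠ 0 := mul_ne_zero (C_ne_zero.2 hb) (pow_ne_zero n X_ne_zero)
  have he : e ≠ 0 := by rintro rfl; rw [zero_mul] at hq; exact h0 hq
  have hq0 : q ≠ 0 := by rintro rfl; rw [mul_zero] at hq; exact h0 hq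
  have h1 := natDegree_C_mul_X_pow n b hb
  have h2 : (C b * X ^ n).natTrailingDegree = n := by
    rw [C_mul_X_pow_eq_monomial, natTrailingDegree_monomial hb]
  rw [hq, natDegree_mul he hq0] at h1
  rw [hq, natTrailingDegree_mul he hq0] at h2
  have h3 := natTrailingDegree_le_natDegree e
  have h4 := natTrailingDegree_le_natDegree q
  refine ⟨e.coeff e.natDegree, e.natDegree, ?_⟩
  ext k
  rw [coeff_C_mul_X_pow]
  split_ifs with hk
  · rw [hk]
  · rcases lt_or_gt_of_ne hk with hk | hk
    · exact coeff_eq_zero_of_lt_natTrailingDegree (by omega)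
    · exact coeff_eq_zero_of_natDegree_lt hk

/-! ### Finitely generated ideals of `A + X B[X]` up to homogeneous factors -/

/-- The nonzero homogeneous elements of `A + X B[X]`. -/
noncomputable def homogeneousDenominators (A : Subring B) : Submonoid (composite A) :=
  SetLike.homogeneousSubmonoid (compositeGrading A) ⊓ (composite A)⁰

/-- Inverting the nonzero homogeneous elements of `A + X B[X]` gives the principal ideal domain
`L[X, X⁻¹]`, with `L` the quotient field of `B`. Hence a finitely generated ideal is principal
up to a homogeneous factor. -/
theorem exists_dvd_homogeneous_mul {J : Ideal (composite A)} (hJ : J.FG) (hJ0 : J ≠ ⊥) :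
    ∃ w ∈ J, w ≠ 0 ∧ ∃ s ∈ homogeneousDenominators A, ∀ j ∈ J, w ∣ s * j := by
  set L := FractionRing B
  set φ : composite A →+* L[X] := (mapRingHom (algebraMap B L)).comp (composite A).subtype
  have hφ : Function.Injective φ :=
    (map_injective _ (IsFractionRing.injective B L)).comp Subtype.val_injective
  have hclear : ∀ q : L[X], ∃ s ∈ homogeneousDenominators A, ∃ r, φ r = φ s * q := by
    intro q
    obtain ⟨d, hd0, hd⟩ := IsLocalization.integerNormalization_spec B⁰ q
    refine ⟨compositeXMul A (C d), ⟨⟨1, d, ?_⟩, ?_⟩, compositeXMul A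
      (IsLocalization.integerNormalization B⁰ q), ?_⟩
    · rw [coe_compositeXMul, pow_one, mul_comm]
    · refine mem_nonZeroDivisors_of_ne_zero fun h0 => ?_
      have := congrArg (fun p : composite A => (p : B[X]).coeff 1) h0
      rw [coe_compositeXMul, coeff_X_mul, coeff_C_zero] at this
      exact nonZeroDivisors.ne_zero hd0 this
    · change (X * _ : B[X]).map _ = (X * C d : B[X]).map _ * q
      rw [Polynomial.map_mul, Polynomial.map_mul, hd, map_X, map_C, mul_assoc, ← smul_eq_C_mul,
        algebraMap_smul]
  obtain ⟨f, hf⟩ : ∃ f, J.map φ = Ideal.span {f} :=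
    (IsPrincipalIdealRing.principal (J.map φ)).principal
  have hmem : ∀ p ∈ J.map φ, ∃ s ∈ homogeneousDenominators A, ∃ w ∈ J, φ w = φ s * p := by
    intro p hp
    induction hp using Submodule.span_induction with
    | mem x hx =>
      obtain ⟨j, hj, rfl⟩ := hx
      exact ⟨1, one_mem _, j, hj, by rw [map_one, one_mul]⟩
    | zero => exact ⟨1, one_mem _, 0, J.zero_mem, by rw [map_zero, mul_zero]⟩
    | add x y _ _ hx hy =>
      obtain ⟨s, hs, w, hw, h⟩ := hx
      obtain ⟨t, ht, v, hv, h'⟩ := hy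
      refine ⟨s * t, mul_mem hs ht, t * w + s * v,
        J.add_mem (J.mul_mem_left _ hw) (J.mul_mem_left _ hv), ?_⟩
      rw [map_add, map_mul, map_mul, map_mul, h, h']
      ring
    | smul a x _ hx =>
      obtain ⟨s, hs, w, hw, h⟩ := hx
      obtain ⟨t, ht, r, hr⟩ := hclear a
      refine ⟨s * t, mul_mem hs ht, r * w, J.mul_mem_left _ hw, ?_⟩
      rw [map_mul, map_mul, h, hr, smul_eq_mul]
      ring
  have hf0 : f ≠ 0 := by
    rintro rfl
    rw [Ideal.span_singleton_eq_bot.2 rfl, Ideal.map_eq_bot_iff_of_injective hφ] at hf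
    exact hJ0 hf
  obtain ⟨s₀, hs₀, w, hw, hwf⟩ := hmem f (hf ▸ Ideal.mem_span_singleton_self f)
  have hw0 : w ≠ 0 := by
    rintro rfl
    rw [map_zero, eq_comm, mul_eq_zero, map_eq_zero_iff φ hφ] at hwf
    exact hwf.elim (nonZeroDivisors.ne_zero hs₀.2) hf0
  have hone : ∀ j ∈ J, ∃ s ∈ homogeneousDenominators A, w ∣ s * j := by
    intro j hj
    have hjf := Ideal.mem_map_of_mem φ hj
    rw [hf] at hjf
    obtain ⟨l, hl⟩ := Ideal.mem_span_singleton.1 hjf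
    obtain ⟨s, hs, r, hr⟩ := hclear l
    refine ⟨s₀ * s, mul_mem hs₀ hs, r, hφ ?_⟩
    rw [map_mul, map_mul, map_mul, hl, hr, hwf]
    ring
  obtain ⟨T, rfl⟩ := hJ
  choose! σ hσ hσ' using hone
  refine ⟨w, hw, hw0, ∏ j ∈ T, σ j,
    prod_mem fun j hj => hσ j (Submodule.subset_span hj), fun j hj => ?_⟩
  induction hj using Submodule.span_induction with
  | mem x hx =>
    exact (hσ' x (Submodule.subset_span hx)).trans
      (mul_dvd_mul_right (Finset.dvd_prod_of_mem σ hx) x)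
  | zero => rw [mul_zero]; exact dvd_zero _
  | add x y _ _ hx hy => rw [mul_add]; exact dvd_add hx hy
  | smul a x _ hx => rw [smul_eq_mul, mul_left_comm]; exact hx.mul_left a

end Composite

end GradedDomain

/-! ### The class group of `A + X B[X]` -/

namespace GradedDomain

open Polynomial
open scoped nonZeroDivisors
open FractionalIdeal (spanSingleton)

variable {B : Type*} [CommRing B] [IsDomain B]

theorem HCl_compositeGrading_eq_top [IsIntegrallyClosed B] (A : Subring B) :
    HCl (compositeGrading A) = ⊤ := by
  refine (Subgroup.eq_top_iff' _).2 fun x => ?_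
  obtain ⟨u, rfl⟩ := QuotientGroup.mk_surjective x
  rw [mk_mem_HCl]
  let φ := algebraMap (composite A) (FractionRing (composite A))
  have hinj : Function.Injective φ := IsFractionRing.injective _ _
  obtain ⟨F, hF, hF0, hf, hFu⟩ := u.exists_fg
  obtain ⟨d, J, hd0, rfl⟩ := FractionalIdeal.exists_eq_spanSingleton_mul F
  have hd : φ d ≠ 0 := (map_ne_zero_iff _ hinj).2 hd0
  have hJ0 : J ≠ ⊥ := by
    rintro rfl
    exact hF0 (by rw [FractionalIdeal.coeIdeal_bot, mul_zero])
  have hJ : J.FG := by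
    rw [← FractionalIdeal.coeIdeal_fg (composite A)⁰ hinj]
    have h1 : (J : FractionalIdeal (composite A)⁰ (FractionRing (composite A))) =
        spanSingleton (composite A)⁰ (φ d) * (spanSingleton (composite A)⁰ (φ d)⁻¹ * J) := by
      rw [← mul_assoc, FractionalIdeal.spanSingleton_mul_spanSingleton, mul_inv_cancel₀ hd,
        FractionalIdeal.spanSingleton_one, one_mul]
    rw [h1, FractionalIdeal.coe_mul, FractionalIdeal.coe_spanSingleton]
    exact (Submodule.fg_span_singleton _).mul hf
  obtain ⟨w, hwJ, hw0, s, hs, hdvd⟩ := exists_dvd_homogeneous_mul hJ hJ0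
  have hs0 : s ≠ 0 := nonZeroDivisors.ne_zero hs.2
  have hw : φ w ≠ 0 := (map_ne_zero_iff _ hinj).2 hw0
  have hs' : φ s ≠ 0 := (map_ne_zero_iff _ hinj).2 hs0
  -- With `F = d⁻¹ J` inside the given `t`-ideal, multiplication by `s d / w`
  -- makes that `t`-ideal integral, and sends `w / d` to `s`.
  refine ⟨φ s * φ d / φ w,
    div_ne_zero (mul_ne_zero hs' hd) hw, isHomogeneousFractional_of_mem ?_ ?_ hs0 ?_
    fun f g hfg i => dvd_decompose_mul hs0 hs.1 hfg i⟩
  · rw [tClosure_spanSingleton_mul, u.val.tClosure_eq]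
  · refine FractionalIdeal.spanSingleton_mul_le_iff.2 (hFu _ fun y hy => ?_)
    obtain ⟨j, hj, rfl⟩ := FractionalIdeal.mem_singleton_mul.1 hy
    obtain ⟨r, hr, rfl⟩ := (FractionalIdeal.mem_coeIdeal (composite A)⁰).1 hj
    obtain ⟨v, hv⟩ := hdvd r hr
    refine (FractionalIdeal.mem_one_iff _).2 ⟨v, ?_⟩
    have := congrArg φ hv
    rw [map_mul, map_mul] at this
    change φ v = φ s * φ d / φ w * ((φ d)⁻¹ * φ r)
    field_simp
    rw [mul_comm, ← this]
  · refine FractionalIdeal.mem_singleton_mul.2 ⟨(φ d)⁻¹ * φ w, hF ?_, ?_⟩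
    · exact FractionalIdeal.mem_singleton_mul.2
        ⟨_, (FractionalIdeal.mem_coeIdeal (composite A)⁰).2 ⟨w, hwJ, rfl⟩, rfl⟩
    · change φ s = φ s * φ d / φ w * ((φ d)⁻¹ * φ w)
      field_simp

/-- With `σ = b² X²`, the `t`-ideals generated by `X Q, σ` and by `X H, σ` are inverse to each
other up to the factor `σ`. If a multiple of the first were homogeneous, it would contain the
lowest component `b X` of `X Q`, so `σ` would divide `b X · X H`, that is, `b` would divide `H`. -/
theorem isIntegrallyClosed_of_HCl_eq_top {A : Subring B} (h : HCl (compositeGrading A) = ⊤) :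
    IsIntegrallyClosed B := by
  by_contra hB
  obtain ⟨b, H, Q, g, hb, hQ, hHQ, hg, hbH⟩ := exists_mul_eq_of_not_isIntegrallyClosed hB
  set R := composite A
  set K := FractionRing R
  have hinj : Function.Injective (algebraMap R K) := IsFractionRing.injective R K
  set σ : R := compositeXMul A (C (b ^ 2) * X)
  have hσ : (σ : B[X]) = C (b ^ 2) * X ^ 2 := by
    rw [coe_compositeXMul]; ring
  have hσh := isHomogeneousElem_of_coe_eq hσ
  have hσ0 : σ ≠ 0 := fun h0 => by
    rw [h0] at hσ
    exact mul_ne_zero (C_ne_zero.2 (pow_ne_zero 2 hb)) (pow_ne_zero 2 X_ne_zero) hσ.symm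
  have hσ0' : algebraMap R K σ ≠ 0 := (map_ne_zero_iff _ hinj).2 hσ0
  let g' : R := ⟨g, mem_composite.2 (hg ▸ A.one_mem)⟩
  have hxy : compositeXMul A Q * compositeXMul A H = σ * g' := Subtype.ext <| by
    rw [Subring.coe_mul, Subring.coe_mul, hσ, coe_compositeXMul, coe_compositeXMul]
    linear_combination X ^ 2 * hHQ
  set 𝔞 : Ideal R := Ideal.span {compositeXMul A Q, σ}
  set 𝔟 : Ideal R := Ideal.span {compositeXMul A H, σ}
  have hab : 𝔞 * 𝔟 ≤ Ideal.span {σ} := by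
    rw [Ideal.span_pair_mul_span_pair, Ideal.span_le]
    rintro y (rfl | rfl | rfl | rfl)
    · exact Ideal.mem_span_singleton.2 ⟨g', hxy⟩
    · exact Ideal.mem_span_singleton.2 (dvd_mul_left _ _)
    · exact Ideal.mem_span_singleton.2 (dvd_mul_right _ _)
    · exact Ideal.mem_span_singleton.2 (dvd_mul_right _ _)
  have hσab : algebraMap R K σ ∈
      tClosure ((𝔞 : FractionalIdeal R⁰ K) * (𝔟 : FractionalIdeal R⁰ K)) := by
    have h1 : compositeXMul A Q * compositeXMul A H ∈ 𝔞 * 𝔟 :=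
      Ideal.mul_mem_mul (Ideal.subset_span (by simp)) (Ideal.subset_span (by simp))
    have h2 : σ * σ ∈ 𝔞 * 𝔟 :=
      Ideal.mul_mem_mul (Ideal.subset_span (by simp)) (Ideal.subset_span (by simp))
    rw [← FractionalIdeal.coeIdeal_mul]
    refine ⟨(Ideal.span {compositeXMul A Q * compositeXMul A H, σ * σ} : Ideal R), ?_, ?_, ?_⟩
    · rw [FractionalIdeal.coeIdeal_le_coeIdeal, Ideal.span_le]
      rintro y (rfl | rfl)
      · exact h1
      · exact h2
    · exact (FractionalIdeal.coeIdeal_fg R⁰ hinj _).2 (Submodule.fg_span (Set.toFinite _))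
    have hne : Ideal.span {compositeXMul A Q * compositeXMul A H, σ * σ} ≠ ⊥ := fun h0 =>
      mul_ne_zero hσ0 hσ0 (Ideal.mem_bot.1 (h0 ▸ Ideal.subset_span (by simp)))
    refine (mem_vClosure (FractionalIdeal.coeIdeal_ne_zero.2 hne)).2 fun z hz => ?_
    obtain ⟨r, hr⟩ := (FractionalIdeal.mem_one_iff _).1
      (hz _ (FractionalIdeal.mem_coeIdeal_of_mem R⁰ (Ideal.subset_span (Set.mem_insert _ _))))
    obtain ⟨v, hv⟩ := (FractionalIdeal.mem_one_iff _).1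
      (hz _ (FractionalIdeal.mem_coeIdeal_of_mem R⁰
        (Ideal.subset_span (Set.mem_insert_of_mem _ rfl))))
    have hdvd : σ ∣ v * g' := by
      refine ⟨r, hinj ?_⟩
      rw [map_mul, map_mul, hr, hv, hxy, map_mul, map_mul]
      ring
    obtain ⟨q, rfl⟩ := dvd_of_dvd_mul_of_coeff_zero_eq_one hσ0 hσh hg hdvd
    refine (FractionalIdeal.mem_one_iff _).2 ⟨q, mul_left_cancel₀ hσ0' ?_⟩
    rw [← map_mul, hv, map_mul]
    ring
  have htab : tClosure ((𝔞 : FractionalIdeal R⁰ K) * (𝔟 : FractionalIdeal R⁰ K)) =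
      spanSingleton R⁰ (algebraMap R K σ) := by
    refine le_antisymm ?_ (FractionalIdeal.spanSingleton_le_iff_mem.2 hσab)
    rw [← tClosure_spanSingleton, ← FractionalIdeal.coeIdeal_mul,
      ← FractionalIdeal.coeIdeal_span_singleton]
    exact tClosure_mono ((FractionalIdeal.coeIdeal_le_coeIdeal K).2 hab)
  -- Here `k = s c` multiplies the `t`-ideal onto a homogeneous integral ideal `J`.
  obtain ⟨u, hu⟩ := exists_tInvertible_of_tClosure_mul hσ0' htab
  obtain ⟨c, hc, s, hs0, -, J, hJ, hcJ⟩ := mk_mem_HCl.1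
    (h ▸ Subgroup.mem_top _ : (QuotientGroup.mk u : Cl R) ∈ HCl (compositeGrading A))
  rw [hu, ← mul_assoc, FractionalIdeal.spanSingleton_mul_spanSingleton] at hcJ
  set k : K := algebraMap R K s * c
  have hk : k ≠ 0 := mul_ne_zero ((map_ne_zero_iff _ hinj).2 hs0) hc
  have ht1 : tClosure (𝔞 : FractionalIdeal R⁰ K) ≤ 1 := by
    rw [← tClosure_one]
    exact tClosure_mono FractionalIdeal.coeIdeal_le_one
  have hmem : ∀ a ∈ 𝔞, ∃ j ∈ J, algebraMap R K j = k * algebraMap R K a := fun a ha => by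
    have : k * algebraMap R K a ∈ (J : FractionalIdeal R⁰ K) := by
      rw [← hcJ]
      exact FractionalIdeal.mem_singleton_mul.2
        ⟨_, le_tClosure _ (FractionalIdeal.mem_coeIdeal_of_mem R⁰ ha), rfl⟩
    exact (FractionalIdeal.mem_coeIdeal R⁰).1 this
  -- The element `k σ` of `J` divides `σ` times each of its components, so it is a monomial.
  obtain ⟨e, he, hek⟩ := hmem σ (Ideal.subset_span (by simp))
  have he0 : e ≠ 0 := by
    rintro rfl
    rw [map_zero] at hek
    exact mul_ne_zero hk hσ0' hek.symm
  have he0' : (e : B[X]) ≠ 0 := fun h0 => he0 (Subtype.ext h0)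
  obtain ⟨d, m, hdm⟩ : ∃ d m, (e : B[X]) = C d * X ^ m := by
    set n := (e : B[X]).natDegree
    obtain ⟨y, hy, hye⟩ := (mem_iff_of_spanSingleton_mul_eq hcJ).1 (hJ n he)
    obtain ⟨y', rfl⟩ := (FractionalIdeal.mem_one_iff _).1 (ht1 hy)
    have h1 : (DirectSum.decompose (compositeGrading A) e n : R) * σ = e * y' := hinj <| by
      rw [map_mul, map_mul, hek, ← hye]
      ring
    have h2 := congrArg (Subtype.val) h1
    refine exists_eq_C_mul_X_pow_of_dvd (b := (e : B[X]).leadingCoeff * b ^ 2) (n := n + 2)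
      (mul_ne_zero (leadingCoeff_ne_zero.2 he0') (pow_ne_zero 2 hb)) ⟨y', ?_⟩
    rw [← Subring.coe_mul, ← h1, Subring.coe_mul, coe_decompose_composite, hσ, C_mul, pow_add]
    simp only [n, coeff_natDegree]
    ring
  have hd : d ≠ 0 := by
    rintro rfl
    exact he0' (by rw [hdm, C_0, zero_mul])
  -- The component of degree `m + 1` of `e * (X Q)` is `e * (b X)`, and it lies in `σ J`.
  obtain ⟨j, hj, hjk⟩ := hmem (compositeXMul A Q) (Ideal.subset_span (by simp))
  have hej : e * compositeXMul A Q ∈ Ideal.span {σ} * J := by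
    refine Ideal.mem_span_singleton_mul.2 ⟨j, hj, hinj ?_⟩
    rw [map_mul, map_mul, hjk, hek]
    ring
  have hcomp := ((isHomogeneous_span_singleton hσh).mul hJ) (m + 1) hej
  have hcomp' : (DirectSum.decompose (compositeGrading A) (e * compositeXMul A Q) (m + 1) : R) =
      e * compositeXMul A (C b) := Subtype.ext <| by
    rw [coe_decompose_composite, Subring.coe_mul, Subring.coe_mul, hdm, coe_compositeXMul,
      coe_compositeXMul]
    have h1 : C d * X ^ m * (X * Q) = C d * (X ^ (m + 1) * Q) := by ring
    rw [h1, coeff_C_mul, coeff_X_pow_mul', if_pos le_rfl, Nat.sub_self, hQ, C_mul]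
    ring
  rw [hcomp'] at hcomp
  obtain ⟨v, hv, hve⟩ := Ideal.mem_span_singleton_mul.1 hcomp
  obtain ⟨y, hy, hyv⟩ := (mem_iff_of_spanSingleton_mul_eq hcJ).1 hv
  have hyb : y = algebraMap R K (compositeXMul A (C b)) := by
    have h1 := congrArg (algebraMap R K) hve
    rw [map_mul, map_mul, hek, ← hyv] at h1
    refine mul_left_cancel₀ (mul_ne_zero hk hσ0') ?_
    rw [← h1]
    ring
  rw [hyb] at hy
  have hfin := mul_mem_spanSingleton_of_mem_tClosure (z := algebraMap R K (compositeXMul A H))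
    (c := algebraMap R K σ) (fun x hx => by
      obtain ⟨a, ha, rfl⟩ := (FractionalIdeal.mem_coeIdeal R⁰).1 hx
      rw [← map_mul, ← FractionalIdeal.coeIdeal_span_singleton, mul_comm]
      exact FractionalIdeal.mem_coeIdeal_of_mem R⁰
        (hab (Ideal.mul_mem_mul ha (Ideal.subset_span (by simp))))) hy
  rw [← map_mul, ← FractionalIdeal.coeIdeal_span_singleton] at hfin
  obtain ⟨r, hr, hrH⟩ := (FractionalIdeal.mem_coeIdeal R⁰).1 hfin
  obtain ⟨q, rfl⟩ := Ideal.mem_span_singleton.1 hr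
  have h1 := congrArg Subtype.val (hinj hrH)
  rw [Subring.coe_mul, Subring.coe_mul, hσ, coe_compositeXMul, coe_compositeXMul] at h1
  refine hbH ⟨q, mul_left_cancel₀ (mul_ne_zero (C_ne_zero.2 hb) (pow_ne_zero 2 X_ne_zero)) ?_⟩
  rw [C_pow] at h1
  linear_combination -h1

end GradedDomain

theorem corollary1p10 {B : Type*} [CommRing B] [IsDomain B] (A : Subring B) :
    GradedDomain.HCl (GradedDomain.compositeGrading A) = ⊤ ↔ IsIntegrallyClosed B :=
  ⟨GradedDomain.isIntegrallyClosed_of_HCl_eq_top,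
    fun _ => GradedDomain.HCl_compositeGrading_eq_top A⟩
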